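/- All Hilbert spaces are complex and separable; $\mathbb D$ is the open unit disc, $\mathbb T$ the unit circle with normalized Lebesgue measure, and $L^2(\mathcal L)$ is the Hilbert space of square integrable $\mathcal L$-valued functions on $\mathbb T$. **Couplings.** A *unitary coupling* $\sigma=(\mathcal H,\mathcal F,\mathcal G;U,V_{\mathcal F},V_{\mathcal G})$ consists of Hilbert spaces $\mathcal H,\mathcal F,\mathcal G$, a unitary operator $U$ on $\mathcal H$, and isometries $V_{\mathcal F}:\mathcal F\to\mathcal H$, $V_{\mathcal G}:\mathcal G\to\mathcal H$ whose ranges $\mathring{\mathcal F}$, $\mathring{\mathcal G}$ are wandering for $U$ (for $\mathcal N=\mathring{\mathcal F}$ and for $\mathcal N=\mathring{\mathcal G}$, the subspaces $U^k\mathcal N$, $k\in\mathbb Z$, are pairwise orthogonal). For a wandering subspace $\mathcal N$ put $M(\mathcal N)=\bigoplus_{k\in\mathbb Z}U^k\mathcal N$, $M_+(\mathcal N)=\bigoplus_{k\ge 0}U^k\mathcal N$, $M_-(\mathcal N)=\bigoplus_{k\le -1}U^k\mathcal N$. The coupling is *orthogonal* if $M_-(\mathring{\mathcal F})\perp M_+(\mathring{\mathcal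 G})$. **Scattering suboperator.** For $\mathcal L\in\{\mathcal F,\mathcal G\}$ let $\Phi_{\mathcal L}:\mathcal H\to L^2(\mathcal L)$, $(\Phi_{\mathcal L}h)(t)=\sum_{k\in\mathbb Z}t^kV_{\mathcal L}^*U^{-k}h$ (convergence in $L^2(\mathcal L)$), and let $S_\sigma:M(\mathring{\mathcal G})\to M(\mathring{\mathcal F})$ be the restriction to $M(\mathring{\mathcal G})$ of the orthogonal projection onto $M(\mathring{\mathcal F})$. The *scattering operator* is $\hat\vartheta_\sigma=\Phi_{\mathcal F}S_\sigma\Phi_{\mathcal G}^*:L^2(\mathcal G)\to L^2(\mathcal F)$. The *scattering suboperator* $\vartheta_\sigma$ is the strongly measurable function on $\mathbb T$ whose values are bounded operators $\mathcal G\to\mathcal F$, with $\|\vartheta_\sigma(t)\|\le 1$ almost everywhere, such that $\vartheta_\sigma(t)g(t)=(\hat\vartheta_\sigma g)(t)$ almost everywhere for every $g\in L^2(\mathcal G)$; it is considered up to equality almost everywhere. **Colligations.** A colligation $\Delta=(\mathcal K,\mathcal F,\mathcal G;T,F,G,S)$ consists of Hilbert spaces and bounded operators $T:\mathcal K\to\mathcal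 K$, $F:\mathcal F\to\mathcal K$, $G:\mathcal K\to\mathcal G$, $S:\mathcal F\to\mathcal G$; it is *unitary* if $\begin{pmatrix}T&F\\G&S\end{pmatrix}:\mathcal K\oplus\mathcal F\to\mathcal K\oplus\mathcal G$ is unitary. Its characteristic function is $\theta_\Delta(\zeta)=S+\zeta G(I-\zeta T)^{-1}F$, $\zeta\in\mathbb D$. The associated colligation is $\Delta^\sim=(\mathcal K,\mathcal G,\mathcal F;T^*,G^*,F^*,S^*)$, and the associated function is $\theta_\Delta^\sim(\zeta)=\theta_\Delta(\bar\zeta)^*$. The colligation *generated by* an orthogonal coupling $\sigma$ has $\mathcal K=\mathcal H\ominus\bigl(M_-(\mathring{\mathcal F})\oplus M_+(\mathring{\mathcal G})\bigr)$ and, with $P$ the orthogonal projection of $\mathcal H$ onto $\mathcal K$, $T=PU|_{\mathcal K}$, $F=PV_{\mathcal F}$, $G=V_{\mathcal G}^*U|_{\mathcal K}$, $S=V_{\mathcal G}^*V_{\mathcal F}$. **Boundary values.** The strong boundary value function $\underline\theta$ of a function $\theta$ on $\mathbb D$ with values in the bounded operators $\mathcal G\to\mathcal F$ is defined, up to equality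 almost everywhere, by: for almost every $t\in\mathbb T$, for all $g\in\mathcal G$, $\theta(\zeta)g\to\underline\theta(t)g$ as $\zeta\to t$ nontangentially. **Theorem.** Let $\sigma$ be an orthogonal unitary coupling and $\Delta$ the colligation generated by $\sigma$. Then $\Delta$ is a unitary colligation; $\theta_{\Delta^\sim}$ is a Schur function (holomorphic and contractive on $\mathbb D$) and $\theta_{\Delta^\sim}=\theta_\Delta^\sim$ on $\mathbb D$; the scattering suboperator $\vartheta_\sigma$ and the strong boundary value function of $\theta_{\Delta^\sim}$ exist and are unique up to equality almost everywhere, and $$\vartheta_\sigma=\underline{\theta_{\Delta^\sim}}=\underline{\theta_\Delta^\sim}\qquad\text{almost everywhere on }\mathbb T.$$ -/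

import Mathlib

open MeasureTheory Filter Topology

open scoped Real InnerProductSpace ENNReal ComplexConjugate

namespace ScatteringTheory

noncomputable section

/-! ## The unit circle and the spaces `L²(𝓛)` -/

instance factTwoPiPos : Fact (0 < 2 * π) := ⟨Real.two_pi_pos⟩

/-- The unit circle, parametrized by the angle: the class of `x` stands for `t = exp (i x)`. -/
abbrev UCircle : Type := AddCircle (2 * π)

/-- The Lebesgue measure of the circle divided by `2 π`. -/
abbrev circleMeasure : Measure UCircle := AddCircle.haarAddCircle

/-- The point `t = exp (i x)` of the unit circle in `ℂ`. -/
def circlePoint (x : UCircle) : ℂ := (AddCircle.toCircle x : ℂ)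

/-- The Hilbert space of square integrable `𝓛`-valued functions on the circle, with inner product
`(1 / 2 π) ∫ ⟪h₁ t, h₂ t⟫`. -/
abbrev L2 (𝓛 : Type*) [NormedAddCommGroup 𝓛] [InnerProductSpace ℂ 𝓛] : Type _ :=
  Lp 𝓛 2 circleMeasure

section Monomials

variable {𝓛 : Type*} [NormedAddCommGroup 𝓛] [InnerProductSpace ℂ 𝓛]

theorem continuous_circlePoint : Continuous circlePoint :=
  continuous_subtype_val.comp AddCircle.continuous_toCircle

theorem norm_circlePoint (x : UCircle) : ‖circlePoint x‖ = 1 := Circle.norm_coe _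

theorem circlePoint_ne_zero (x : UCircle) : circlePoint x ≠ 0 := Circle.coe_ne_zero _

theorem circlePoint_zpow (x : UCircle) (k : ℤ) : circlePoint x ^ k = fourier k x := by
  rw [fourier_apply, AddCircle.toCircle_zsmul, Circle.coe_zpow, circlePoint]

theorem memLp_monomial (k : ℤ) (a : 𝓛) :
    MemLp (fun x : UCircle => circlePoint x ^ k • a) 2 circleMeasure := by
  refine MemLp.of_bound (C := ‖a‖) ?_ (ae_of_all _ fun x => ?_)
  · exact ((continuous_circlePoint.zpow₀ k fun x => Or.inl (circlePoint_ne_zero x)).smul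
      continuous_const).aestronglyMeasurable
  · rw [norm_smul, norm_zpow, norm_circlePoint, one_zpow, one_mul]

/-- The function `t ↦ t ^ k a` as an element of `L²(𝓛)`. -/
def monomial (k : ℤ) (a : 𝓛) : L2 𝓛 := (memLp_monomial k a).toLp _

theorem inner_monomial (j k : ℤ) (a b : 𝓛) :
    ⟪monomial j a, monomial k b⟫_ℂ = if j = k then ⟪a, b⟫_ℂ else 0 := by
  have h1 : ⟪monomial j a, monomial k b⟫_ℂ
      = ∫ x : UCircle, fourier (k - j) x * ⟪a, b⟫_ℂ ∂circleMeasure := by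
    rw [L2.inner_def]
    refine integral_congr_ae ?_
    filter_upwards [(memLp_monomial j a).coeFn_toLp, (memLp_monomial k b).coeFn_toLp]
      with x h1 h2
    rw [monomial, monomial, h1, h2, inner_smul_left, inner_smul_right, circlePoint_zpow,
      circlePoint_zpow, ← fourier_neg, ← mul_assoc, ← fourier_add, neg_add_eq_sub]
  rw [h1, integral_mul_const]
  have h2 : ∫ x : UCircle, fourier (k - j) x ∂circleMeasure = if j = k then 1 else 0 := by
    have := orthonormal_iff_ite.1 (orthonormal_fourier (T := 2 * π)) j k
    rw [← this, ContinuousMap.inner_toLp circleMeasure (fourier j) (fourier k)]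
    refine integral_congr_ae (ae_of_all _ fun x => ?_)
    simp only
    rw [sub_eq_add_neg, fourier_add, fourier_neg]
  rw [h2]
  split_ifs <;> simp

/-- `a ↦ t ^ k a` is a linear isometry of `𝓛` into `L²(𝓛)`. -/
def monomialₗᵢ (k : ℤ) : 𝓛 →ₗᵢ[ℂ] L2 𝓛 where
  toFun := monomial k
  map_add' a b := by
    rw [monomial, monomial, monomial, ← MemLp.toLp_add]
    exact MemLp.toLp_congr _ _ (ae_of_all _ fun x => smul_add _ a b)
  map_smul' c a := by
    rw [RingHom.id_apply, monomial, monomial, ← MemLp.toLp_const_smul]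
    exact MemLp.toLp_congr _ _ (ae_of_all _ fun x => smul_comm _ c a)
  norm_map' a := by
    have h := inner_monomial k k a a
    rw [if_pos rfl, inner_self_eq_norm_sq_to_K, inner_self_eq_norm_sq_to_K] at h
    exact (pow_left_inj₀ (norm_nonneg _) (norm_nonneg _) two_ne_zero).1 (by exact_mod_cast h)

theorem orthogonalFamily_monomial :
    OrthogonalFamily ℂ (fun _ : ℤ => 𝓛) (fun k => monomialₗᵢ (𝓛 := 𝓛) k) := by
  intro j k hjk a b
  exact (inner_monomial j k a b).trans (if_neg hjk)

end Monomials

/-! ## Wandering subspaces and the Fourier representation -/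

section Wandering

variable {𝓗 𝓛 : Type*} [NormedAddCommGroup 𝓗] [InnerProductSpace ℂ 𝓗]
  [NormedAddCommGroup 𝓛] [InnerProductSpace ℂ 𝓛]

/-- The subspace `U ^ k N`. -/
def shifted (U : 𝓗 ≃ₗᵢ[ℂ] 𝓗) (N : Submodule ℂ 𝓗) (k : ℤ) : Submodule ℂ 𝓗 :=
  N.map (U ^ k : 𝓗 ≃ₗᵢ[ℂ] 𝓗).toLinearEquiv.toLinearMap

/-- `N` is wandering for `U`: the subspaces `U ^ k N` are pairwise orthogonal. -/
def IsWandering (U : 𝓗 ≃ₗᵢ[ℂ] 𝓗) (N : Submodule ℂ 𝓗) : Prop :=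
  ∀ j k : ℤ, j ≠ k → shifted U N j ⟂ shifted U N k

/-- The closed linear span of the subspaces `U ^ k N` for all integers `k`. -/
def spanAll (U : 𝓗 ≃ₗᵢ[ℂ] 𝓗) (N : Submodule ℂ 𝓗) : Submodule ℂ 𝓗 :=
  (⨆ k : ℤ, shifted U N k).topologicalClosure

/-- The closed linear span of the subspaces `U ^ k N` for `k ≥ 0`. -/
def spanPlus (U : 𝓗 ≃ₗᵢ[ℂ] 𝓗) (N : Submodule ℂ 𝓗) : Submodule ℂ 𝓗 :=
  (⨆ k : ℤ, ⨆ _ : 0 ≤ k, shifted U N k).topologicalClosure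

/-- The closed linear span of the subspaces `U ^ k N` for `k ≤ -1`. -/
def spanMinus (U : 𝓗 ≃ₗᵢ[ℂ] 𝓗) (N : Submodule ℂ 𝓗) : Submodule ℂ 𝓗 :=
  (⨆ k : ℤ, ⨆ _ : k ≤ -1, shifted U N k).topologicalClosure

instance [CompleteSpace 𝓗] (U : 𝓗 ≃ₗᵢ[ℂ] 𝓗) (N : Submodule ℂ 𝓗) :
    CompleteSpace (spanAll U N) :=
  (Submodule.isClosed_topologicalClosure _).completeSpace_coe

/-- The range of an isometric operator. -/
def rangeOf (V : 𝓛 →ₗᵢ[ℂ] 𝓗) : Submodule ℂ 𝓗 := LinearMap.range V.toLinearMap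

theorem orthogonalFamily_shift {U : 𝓗 ≃ₗᵢ[ℂ] 𝓗} {V : 𝓛 →ₗᵢ[ℂ] 𝓗}
    (hV : IsWandering U (rangeOf V)) :
    OrthogonalFamily ℂ (fun _ : ℤ => 𝓛)
      (fun k => (U ^ k : 𝓗 ≃ₗᵢ[ℂ] 𝓗).toLinearIsometry.comp V) := by
  intro j k hjk a b
  exact Submodule.isOrtho_iff_inner_eq.1 (hV j k hjk) _ ⟨V a, ⟨a, rfl⟩, rfl⟩ _ ⟨V b, ⟨b, rfl⟩, rfl⟩

variable [CompleteSpace 𝓗] [CompleteSpace 𝓛]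

/-- The `k`-th Fourier coefficient `V* U⁻ᵏ h`. -/
def coefficient (U : 𝓗 ≃ₗᵢ[ℂ] 𝓗) (V : 𝓛 →ₗᵢ[ℂ] 𝓗) (k : ℤ) (h : 𝓗) : 𝓛 :=
  (V.toContinuousLinearMap).adjoint ((U ^ (-k) : 𝓗 ≃ₗᵢ[ℂ] 𝓗) h)

theorem inner_coefficient (U : 𝓗 ≃ₗᵢ[ℂ] 𝓗) (V : 𝓛 →ₗᵢ[ℂ] 𝓗) (k : ℤ) (h : 𝓗) (a : 𝓛) :
    ⟪a, coefficient U V k h⟫_ℂ = ⟪(U ^ k : 𝓗 ≃ₗᵢ[ℂ] 𝓗) (V a), h⟫_ℂ := by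
  have h1 : (U ^ k : 𝓗 ≃ₗᵢ[ℂ] 𝓗) ((U ^ (-k) : 𝓗 ≃ₗᵢ[ℂ] 𝓗) h) = h := by
    change ((U ^ k : 𝓗 ≃ₗᵢ[ℂ] 𝓗) * U ^ (-k)) h = h
    rw [← zpow_add, add_neg_cancel, zpow_zero]
    rfl
  rw [coefficient, ContinuousLinearMap.adjoint_inner_right,
    ← LinearIsometryEquiv.inner_map_map (U ^ k : 𝓗 ≃ₗᵢ[ℂ] 𝓗), h1]
  rfl

theorem hasSum_coefficient {U : 𝓗 ≃ₗᵢ[ℂ] 𝓗} {V : 𝓛 →ₗᵢ[ℂ] 𝓗}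
    (hV : IsWandering U (rangeOf V)) (h : 𝓗) :
    HasSum (fun k : ℤ => monomial k (coefficient U V k h))
      (orthogonalFamily_monomial.linearIsometry
        ((orthogonalFamily_shift hV).linearIsometry.toContinuousLinearMap.adjoint h)) := by
  classical
  convert orthogonalFamily_monomial.hasSum_linearIsometry
    ((orthogonalFamily_shift hV).linearIsometry.toContinuousLinearMap.adjoint h) using 2 with k
  change _ = monomial k _
  congr 1
  refine ext_inner_left ℂ fun a => ?_
  have h1 := lp.inner_single_left (𝕜 := ℂ) k a
    ((orthogonalFamily_shift hV).linearIsometry.toContinuousLinearMap.adjoint h)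
  have h2 := (orthogonalFamily_shift hV).linearIsometry_apply_single (i := k) a
  rw [inner_coefficient]
  refine Eq.trans ?_ h1
  rw [ContinuousLinearMap.adjoint_inner_right, LinearIsometry.coe_toContinuousLinearMap, h2]
  rfl

/-- The Fourier representation `h ↦ ∑ₖ tᵏ V* U⁻ᵏ h` (sum in `L²(𝓛)`) of the unitary operator `U`
and the isometry `V` with wandering range. -/
def fourierRep (U : 𝓗 ≃ₗᵢ[ℂ] 𝓗) (V : 𝓛 →ₗᵢ[ℂ] 𝓗) (hV : IsWandering U (rangeOf V)) :
    𝓗 →L[ℂ] L2 𝓛 where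
  toFun h := ∑' k : ℤ, monomial k (coefficient U V k h)
  map_add' h h' := by
    simp only [(hasSum_coefficient hV _).tsum_eq, map_add]
  map_smul' c h := by
    simp only [(hasSum_coefficient hV _).tsum_eq, map_smul, RingHom.id_apply]
  cont := by
    simp only [(hasSum_coefficient hV _).tsum_eq]
    fun_prop

end Wandering

/-! ## Unitary couplings and their scattering suboperators -/

/-- A unitary coupling `(𝓗, 𝓕, 𝓖; U, V_𝓕, V_𝓖)`: a unitary operator `U` on `𝓗` and two isometries
into `𝓗` whose ranges are wandering for `U`. -/
structure UnitaryCoupling (𝓗 𝓕 𝓖 : Type*)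
    [NormedAddCommGroup 𝓗] [InnerProductSpace ℂ 𝓗]
    [NormedAddCommGroup 𝓕] [InnerProductSpace ℂ 𝓕]
    [NormedAddCommGroup 𝓖] [InnerProductSpace ℂ 𝓖] where
  U : 𝓗 ≃ₗᵢ[ℂ] 𝓗
  VF : 𝓕 →ₗᵢ[ℂ] 𝓗
  VG : 𝓖 →ₗᵢ[ℂ] 𝓗
  wanderingF : IsWandering U (rangeOf VF)
  wanderingG : IsWandering U (rangeOf VG)

/-- A colligation `(𝓗, 𝓕, 𝓖; T, F, G, S)`. -/
structure Colligation (𝓗 𝓕 𝓖 : Type*)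
    [NormedAddCommGroup 𝓗] [InnerProductSpace ℂ 𝓗]
    [NormedAddCommGroup 𝓕] [InnerProductSpace ℂ 𝓕]
    [NormedAddCommGroup 𝓖] [InnerProductSpace ℂ 𝓖] where
  T : 𝓗 →L[ℂ] 𝓗
  F : 𝓕 →L[ℂ] 𝓗
  G : 𝓗 →L[ℂ] 𝓖
  S : 𝓕 →L[ℂ] 𝓖

section Main

variable {𝓗 𝓕 𝓖 : Type*}
  [NormedAddCommGroup 𝓗] [InnerProductSpace ℂ 𝓗] [CompleteSpace 𝓗]
  [NormedAddCommGroup 𝓕] [InnerProductSpace ℂ 𝓕] [CompleteSpace 𝓕]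
  [NormedAddCommGroup 𝓖] [InnerProductSpace ℂ 𝓖] [CompleteSpace 𝓖]

namespace UnitaryCoupling

/-- The closed span of the subspaces `U ^ k V_𝓕 𝓕`, `k ∈ ℤ`. -/
abbrev MF (σ : UnitaryCoupling 𝓗 𝓕 𝓖) : Submodule ℂ 𝓗 := spanAll σ.U (rangeOf σ.VF)

/-- The closed span of the subspaces `U ^ k V_𝓖 𝓖`, `k ∈ ℤ`. -/
abbrev MG (σ : UnitaryCoupling 𝓗 𝓕 𝓖) : Submodule ℂ 𝓗 := spanAll σ.U (rangeOf σ.VG)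

/-- The orthogonal projection onto `MF`, restricted to `MG`. -/
def projMGtoMF (σ : UnitaryCoupling 𝓗 𝓕 𝓖) : σ.MG →L[ℂ] σ.MF :=
  σ.MF.orthogonalProjectionOnto ∘L σ.MG.subtypeL

/-- The Fourier representation of `(U, V_𝓕)` restricted to `MF`. -/
def fourierF (σ : UnitaryCoupling 𝓗 𝓕 𝓖) : σ.MF →L[ℂ] L2 𝓕 :=
  fourierRep σ.U σ.VF σ.wanderingF ∘L σ.MF.subtypeL

/-- The Fourier representation of `(U, V_𝓖)` restricted to `MG`. -/
def fourierG (σ : UnitaryCoupling 𝓗 𝓕 𝓖) : σ.MG →L[ℂ] L2 𝓖 :=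
  fourierRep σ.U σ.VG σ.wanderingG ∘L σ.MG.subtypeL

/-- The scattering operator `L²(𝓖) → L²(𝓕)` of a coupling. -/
def scatteringOperator (σ : UnitaryCoupling 𝓗 𝓕 𝓖) : L2 𝓖 →L[ℂ] L2 𝓕 :=
  σ.fourierF ∘L σ.projMGtoMF ∘L σ.fourierG.adjoint

end UnitaryCoupling

/-- Contractive (strongly) measurable operator functions on the circle. -/
structure IsContractiveMeasurable (ϑ : UCircle → 𝓖 →L[ℂ] 𝓕) : Prop where
  measurable : ∀ g : 𝓖, AEStronglyMeasurable (fun x => ϑ x g) circleMeasure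
  contractive : ∀ᵐ x ∂circleMeasure, ‖ϑ x‖ ≤ 1

/-- `ϑ` is (a representative of) the scattering suboperator of `σ`: the contractive measurable
operator function such that the scattering operator is the multiplication by `ϑ`. -/
structure IsScatteringSuboperator (σ : UnitaryCoupling 𝓗 𝓕 𝓖) (ϑ : UCircle → 𝓖 →L[ℂ] 𝓕) :
    Prop where
  mem : IsContractiveMeasurable ϑ
  mul : ∀ g : L2 𝓖, ∀ᵐ x ∂circleMeasure, ϑ x (g x) = σ.scatteringOperator g x

/-- The coupling is orthogonal: the closed span of `U ^ k V_𝓕 𝓕`, `k ≤ -1`, is orthogonal to the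
closed span of `U ^ k V_𝓖 𝓖`, `k ≥ 0`. -/
def UnitaryCoupling.IsOrthogonal (σ : UnitaryCoupling 𝓗 𝓕 𝓖) : Prop :=
  spanMinus σ.U (rangeOf σ.VF) ⟂ spanPlus σ.U (rangeOf σ.VG)

/-! ## Colligations and their characteristic functions -/

namespace Colligation

/-- The block operator `[T F; G S] : 𝓗 ⊕ 𝓕 → 𝓗 ⊕ 𝓖` (Hilbert space direct sums). -/
def blockOperator (Δ : Colligation 𝓗 𝓕 𝓖) : WithLp 2 (𝓗 × 𝓕) →L[ℂ] WithLp 2 (𝓗 × 𝓖) :=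
  (WithLp.prodContinuousLinearEquiv 2 ℂ 𝓗 𝓖).symm.toContinuousLinearMap ∘L
    ((Δ.T.coprod Δ.F).prod (Δ.G.coprod Δ.S)) ∘L
      (WithLp.prodContinuousLinearEquiv 2 ℂ 𝓗 𝓕).toContinuousLinearMap

/-- The colligation is unitary: its block operator `Y` satisfies `Y* Y = 1` and `Y Y* = 1`. -/
def IsUnitary (Δ : Colligation 𝓗 𝓕 𝓖) : Prop :=
  Δ.blockOperator.adjoint ∘L Δ.blockOperator = ContinuousLinearMap.id ℂ _ ∧
    Δ.blockOperator ∘L Δ.blockOperator.adjoint = ContinuousLinearMap.id ℂ _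

/-- The characteristic function `θ(ζ) = S + ζ G (1 - ζ T)⁻¹ F`; only its values on the open unit
disc matter, where `1 - ζ T` is invertible if `T` is a contraction. -/
def charFun (Δ : Colligation 𝓗 𝓕 𝓖) (ζ : ℂ) : 𝓕 →L[ℂ] 𝓖 :=
  Δ.S + ζ • (Δ.G ∘L Ring.inverse (1 - ζ • Δ.T) ∘L Δ.F)

/-- The associated colligation `(𝓗, 𝓖, 𝓕; T*, G*, F*, S*)`. -/
def assoc (Δ : Colligation 𝓗 𝓕 𝓖) : Colligation 𝓗 𝓖 𝓕 where
  T := Δ.T.adjoint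
  F := Δ.G.adjoint
  G := Δ.F.adjoint
  S := Δ.S.adjoint

end Colligation

/-- The associated function `θ~(ζ) = θ(ζ̄)*`. -/
def assocFun (θ : ℂ → 𝓕 →L[ℂ] 𝓖) (ζ : ℂ) : 𝓖 →L[ℂ] 𝓕 := (θ (conj ζ)).adjoint

/-- Schur functions: holomorphic and contractive on the open unit disc. -/
structure IsSchur (θ : ℂ → 𝓖 →L[ℂ] 𝓕) : Prop where
  holomorphic : DifferentiableOn ℂ θ (Metric.ball 0 1)
  contractive : ∀ ζ ∈ Metric.ball (0 : ℂ) 1, ‖θ ζ‖ ≤ 1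

/-- The nontangential approach region of aperture `M` at the point `t` of the unit circle. For
`M > 1` it contains the radius that ends in `t`. -/
def approachRegion (M : ℝ) (t : ℂ) : Set ℂ := {ζ | ‖ζ‖ < 1 ∧ ‖ζ - t‖ < M * (1 - ‖ζ‖)}

/-- `ϑ` is (a representative of) the strong boundary value function of `θ`: for almost every `t` on
the circle, `θ(ζ) g` tends to `ϑ(t) g` for every `g`, as `ζ` tends to `t` nontangentially. -/
def IsStrongBoundaryValue (θ : ℂ → 𝓖 →L[ℂ] 𝓕) (ϑ : UCircle → 𝓖 →L[ℂ] 𝓕) : Prop :=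
  ∀ᵐ x ∂circleMeasure, ∀ g : 𝓖, ∀ M : ℝ,
    Tendsto (fun ζ => θ ζ g) (𝓝[approachRegion M (circlePoint x)] circlePoint x) (𝓝 (ϑ x g))

/-! ## The colligation generated by a coupling -/

namespace UnitaryCoupling

/-- The internal space `𝓗_Δ` of a coupling. -/
def internal (σ : UnitaryCoupling 𝓗 𝓕 𝓖) : Submodule ℂ 𝓗 :=
  (spanMinus σ.U (rangeOf σ.VF) ⊔ spanPlus σ.U (rangeOf σ.VG))ᗮ

instance (σ : UnitaryCoupling 𝓗 𝓕 𝓖) : CompleteSpace σ.internal :=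
  (Submodule.isClosed_orthogonal _).completeSpace_coe

/-- The unitary operator `U` of a coupling as a bounded operator. -/
def UL (σ : UnitaryCoupling 𝓗 𝓕 𝓖) : 𝓗 →L[ℂ] 𝓗 := σ.U.toContinuousLinearEquiv

/-- The colligation generated by a coupling: with `P` the orthogonal projection onto `𝓗_Δ`,
`T = P U` and `G = V_𝓖* U` on `𝓗_Δ`, `F = P V_𝓕`, and `S = V_𝓖* V_𝓕`. -/
def generatedColligation (σ : UnitaryCoupling 𝓗 𝓕 𝓖) : Colligation σ.internal 𝓕 𝓖 where
  T := σ.internal.orthogonalProjectionOnto ∘L σ.UL ∘L σ.internal.subtypeL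
  F := σ.internal.orthogonalProjectionOnto ∘L σ.VF.toContinuousLinearMap
  G := σ.VG.toContinuousLinearMap.adjoint ∘L σ.UL ∘L σ.internal.subtypeL
  S := σ.VG.toContinuousLinearMap.adjoint ∘L σ.VF.toContinuousLinearMap

end UnitaryCoupling

end Main

end

end ScatteringTheory

open ScatteringTheory

/-! Orthogonality splits `𝓗` into the past `M_-(𝓕)`, the internal space `K` and the future `M_+(𝓖)`.
Since `U M_-(𝓕) = M_-(𝓕) ⊕ V_𝓕 𝓕` and `M_+(𝓖) = V_𝓖 𝓖 ⊕ U M_+(𝓖)`, removing `M_-(𝓕) ⊕ U M_+(𝓖)` from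
`𝓗` leaves both `U K ⊕ V_𝓕 𝓕` and `K ⊕ V_𝓖 𝓖`. The block operator reads one decomposition in terms
of the other, hence is unitary (`projection_add_VG`, `projection_add_VF`). The energy balance of a
unitary colligation makes its characteristic function contractive.

For `g` in `𝓖` let `φ_g = Φ_𝓕 V_𝓖 g`. The scattering operator sends `t ^ k g` to `t ^ k φ_g`, so it
is multiplication by the operator function with columns `φ_g`, once these are known to come from
bounded operators. The Fourier coefficients of `φ_g` are `V_𝓕* U⁻ⁿ V_𝓖 g`. They vanish for `n < 0`
by orthogonality. For `n ≥ 0` they are the Taylor coefficients of the associated characteristic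
function applied to `g`, because a component that has entered the future never returns to `K`
(`coefficient_VG`).

Hence that function applied to `g` is the Poisson integral of `φ_g`, and Fatou's theorem at Lebesgue
points gives nontangential limits `φ_g` almost everywhere. Separability of `𝓖` and contractivity
merge the exceptional sets of the different `g` into one (`exists_isStrongBoundaryValue`); the limit
operators are then both the boundary values and the scattering suboperator. -/

namespace ScatteringTheory

noncomputable section

set_option linter.unusedSectionVars false

/-! ## Unitary colligations -/

section Colligations

variable {𝓗 𝓕 𝓖 : Type*}
  [NormedAddCommGroup 𝓗] [InnerProductSpace ℂ 𝓗] [CompleteSpace 𝓗]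
  [NormedAddCommGroup 𝓕] [InnerProductSpace ℂ 𝓕] [CompleteSpace 𝓕]
  [NormedAddCommGroup 𝓖] [InnerProductSpace ℂ 𝓖] [CompleteSpace 𝓖]

namespace Colligation

theorem blockOperator_apply (Δ : Colligation 𝓗 𝓕 𝓖) (x : WithLp 2 (𝓗 × 𝓕)) :
    Δ.blockOperator x = WithLp.toLp 2 (Δ.T x.fst + Δ.F x.snd, Δ.G x.fst + Δ.S x.snd) := rfl

/-- Makes unitarity symmetric under `assoc`, and replaces the abstract adjoint by explicit blocks.
-/
theorem adjoint_blockOperator (Δ : Colligation 𝓗 𝓕 𝓖) :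
    Δ.blockOperator.adjoint = Δ.assoc.blockOperator := by
  symm
  rw [ContinuousLinearMap.eq_adjoint_iff]
  intro x y
  simp only [blockOperator_apply, WithLp.prod_inner_apply, assoc,
    inner_add_left, inner_add_right, ContinuousLinearMap.adjoint_inner_left,
    WithLp.ofLp_fst, WithLp.ofLp_snd]
  ring

theorem assoc_assoc (Δ : Colligation 𝓗 𝓕 𝓖) : Δ.assoc.assoc = Δ := by
  simp [assoc]

theorem IsUnitary.assoc {Δ : Colligation 𝓗 𝓕 𝓖} (h : Δ.IsUnitary) : Δ.assoc.IsUnitary := by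
  refine ⟨?_, ?_⟩ <;> rw [adjoint_blockOperator, assoc_assoc, ← adjoint_blockOperator]
  exacts [h.2, h.1]

/-- Energy balance, the source of the contractivity of both `T` and the characteristic function. -/
theorem IsUnitary.norm_sq_add {Δ : Colligation 𝓗 𝓕 𝓖} (h : Δ.IsUnitary) (x : 𝓗) (f : 𝓕) :
    ‖Δ.T x + Δ.F f‖ ^ 2 + ‖Δ.G x + Δ.S f‖ ^ 2 = ‖x‖ ^ 2 + ‖f‖ ^ 2 := by
  have h1 : ‖Δ.blockOperator (WithLp.toLp 2 (x, f))‖ = ‖WithLp.toLp 2 (x, f)‖ :=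
    (ContinuousLinearMap.norm_map_iff_adjoint_comp_self _).2 h.1 _
  have h2 := congrArg (· ^ 2) h1
  simpa only [WithLp.prod_norm_sq_eq_of_L2, blockOperator_apply, WithLp.toLp_fst,
    WithLp.toLp_snd] using h2

theorem IsUnitary.norm_T_le {Δ : Colligation 𝓗 𝓕 𝓖} (h : Δ.IsUnitary) : ‖Δ.T‖ ≤ 1 := by
  refine ContinuousLinearMap.opNorm_le_bound _ zero_le_one fun x => ?_
  have := h.norm_sq_add x 0
  simp only [map_zero, add_zero, norm_zero, ne_eq, OfNat.ofNat_ne_zero, not_false_eq_true,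
    zero_pow] at this
  rw [one_mul]
  refine (pow_le_pow_iff_left₀ (norm_nonneg _) (norm_nonneg _) two_ne_zero).1 ?_
  nlinarith [sq_nonneg ‖Δ.G x‖]

theorem norm_smul_T_lt {Δ : Colligation 𝓗 𝓕 𝓖} (h : ‖Δ.T‖ ≤ 1) {ζ : ℂ} (hζ : ‖ζ‖ < 1) :
    ‖ζ • Δ.T‖ < 1 := by
  rw [norm_smul]
  nlinarith [norm_nonneg ζ, norm_nonneg Δ.T]

theorem isUnit_one_sub {Δ : Colligation 𝓗 𝓕 𝓖} (h : ‖Δ.T‖ ≤ 1) {ζ : ℂ} (hζ : ‖ζ‖ < 1) :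
    IsUnit (1 - ζ • Δ.T) :=
  (Units.oneSub _ (norm_smul_T_lt h hζ)).isUnit

/-- With `x = (1 - ζ T)⁻¹ F f`, the block operator maps `(ζ x, f)` to `(x, θ(ζ) f)`. The energy
balance gives `‖θ(ζ) f‖² = ‖f‖² - (1 - |ζ|²) ‖x‖²`. -/
theorem IsUnitary.norm_charFun_le {Δ : Colligation 𝓗 𝓕 𝓖} (h : Δ.IsUnitary) {ζ : ℂ}
    (hζ : ‖ζ‖ < 1) : ‖Δ.charFun ζ‖ ≤ 1 := by
  refine ContinuousLinearMap.opNorm_le_bound _ zero_le_one fun f => ?_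
  set x := Ring.inverse (1 - ζ • Δ.T) (Δ.F f) with hx
  have h1 : Δ.T (ζ • x) + Δ.F f = x := by
    have := congrArg (· (Δ.F f)) (Ring.mul_inverse_cancel _ (isUnit_one_sub h.norm_T_le hζ))
    simp only [mul_apply_eq_comp, ← hx, sub_apply, one_apply_eq_self,
      smul_apply] at this
    rw [← this, map_smul]
    abel
  have h2 : Δ.charFun ζ f = Δ.G (ζ • x) + Δ.S f := by
    rw [map_smul, add_comm]
    rfl
  have h3 := h.norm_sq_add (ζ • x) f
  rw [h1, ← h2, norm_smul, mul_pow] at h3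
  have h4 : ‖ζ‖ ^ 2 ≤ 1 := pow_le_one₀ (norm_nonneg _) hζ.le
  rw [one_mul]
  refine (pow_le_pow_iff_left₀ (norm_nonneg _) (norm_nonneg _) two_ne_zero).1 ?_
  nlinarith [sq_nonneg ‖x‖]

theorem differentiableOn_charFun {Δ : Colligation 𝓗 𝓕 𝓖} (h : ‖Δ.T‖ ≤ 1) :
    DifferentiableOn ℂ Δ.charFun (Metric.ball 0 1) := by
  intro ζ hζ
  rw [mem_ball_zero_iff] at hζ
  refine DifferentiableAt.differentiableWithinAt ?_
  have h1 : DifferentiableAt ℂ (fun ζ : ℂ => Ring.inverse (1 - ζ • Δ.T)) ζ := by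
    have h2 : DifferentiableAt ℂ Ring.inverse (1 - ζ • Δ.T) :=
      differentiableAt_inverse (isUnit_one_sub h hζ)
    exact h2.comp (f := fun ζ : ℂ => 1 - ζ • Δ.T) ζ (by fun_prop)
  unfold charFun
  have h3 : DifferentiableAt ℂ
      (fun ζ : ℂ => Δ.G ∘L Ring.inverse (1 - ζ • Δ.T) ∘L Δ.F) ζ :=
    (differentiableAt_const _).clm_comp (h1.clm_comp (differentiableAt_const _))
  fun_prop

theorem IsUnitary.isSchur {Δ : Colligation 𝓗 𝓕 𝓖} (h : Δ.IsUnitary) : IsSchur Δ.charFun :=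
  ⟨differentiableOn_charFun h.norm_T_le, fun _ hζ => h.norm_charFun_le (mem_ball_zero_iff.1 hζ)⟩

theorem assocFun_charFun (Δ : Colligation 𝓗 𝓕 𝓖) (ζ : ℂ) :
    assocFun Δ.charFun ζ = Δ.assoc.charFun ζ := by
  have h1 : (Ring.inverse (1 - conj ζ • Δ.T)).adjoint = Ring.inverse (1 - ζ • Δ.T.adjoint) := by
    rw [← ContinuousLinearMap.star_eq_adjoint, ← Ring.inverse_star, star_sub, star_one, star_smul,
      ContinuousLinearMap.star_eq_adjoint, starRingEnd_apply, star_star]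
  simp only [assocFun, charFun, assoc, map_add, LinearIsometryEquiv.map_smulₛₗ,
    ContinuousLinearMap.adjoint_comp, h1, Complex.conj_conj, ContinuousLinearMap.comp_assoc]

/-- The Taylor coefficients of the characteristic function at the origin. -/
def taylorCoeff (Δ : Colligation 𝓗 𝓕 𝓖) : ℕ → 𝓕 →L[ℂ] 𝓖
  | 0 => Δ.S
  | n + 1 => Δ.G ∘L (Δ.T ^ n) ∘L Δ.F

theorem hasSum_taylorCoeff {Δ : Colligation 𝓗 𝓕 𝓖} (h : ‖Δ.T‖ ≤ 1) {ζ : ℂ} (hζ : ‖ζ‖ < 1)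
    (f : 𝓕) : HasSum (fun n : ℕ => ζ ^ n • Δ.taylorCoeff n f) (Δ.charFun ζ f) := by
  -- The term of index `0` is `S`; the remaining ones are the Neumann series of the resolvent
  -- between `G` and `F`, with one extra factor `ζ`.
  rw [← hasSum_nat_add_iff' 1]
  have h1 : HasSum (fun n : ℕ => (ζ • Δ.T) ^ n) (Ring.inverse (1 - ζ • Δ.T)) := by
    rw [NormedRing.inverse_one_sub _ (norm_smul_T_lt h hζ)]
    exact (summable_geometric_of_norm_lt_one (norm_smul_T_lt h hζ)).hasSum
  have h2 := (h1.mapL (ContinuousLinearMap.apply ℂ 𝓗 (Δ.F f))).mapL (ζ • Δ.G)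
  convert h2 using 1
  · ext n
    simp [taylorCoeff, smul_pow, smul_smul, pow_succ]
  · simp [charFun, taylorCoeff]

theorem adjoint_taylorCoeff (Δ : Colligation 𝓗 𝓕 𝓖) (n : ℕ) :
    (Δ.taylorCoeff n).adjoint = Δ.assoc.taylorCoeff n := by
  cases n with
  | zero => rfl
  | succ n =>
    simp only [taylorCoeff, ContinuousLinearMap.adjoint_comp, assoc, ContinuousLinearMap.comp_assoc,
      ← ContinuousLinearMap.star_eq_adjoint (Δ.T ^ n), star_pow,
      ContinuousLinearMap.star_eq_adjoint Δ.T]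

end Colligation

end Colligations

/-! ## The colligation generated by an orthogonal coupling -/

section Shifts

variable {𝓗 𝓛 : Type*} [NormedAddCommGroup 𝓗] [InnerProductSpace ℂ 𝓗]
  [NormedAddCommGroup 𝓛] [InnerProductSpace ℂ 𝓛]

theorem zpow_add_one_apply (U : 𝓗 ≃ₗᵢ[ℂ] 𝓗) (k : ℤ) (x : 𝓗) :
    (U ^ (k + 1) : 𝓗 ≃ₗᵢ[ℂ] 𝓗) x = U ((U ^ k : 𝓗 ≃ₗᵢ[ℂ] 𝓗) x) := by
  rw [add_comm, zpow_add, zpow_one]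
  rfl

theorem inner_zpow_symm (U : 𝓗 ≃ₗᵢ[ℂ] 𝓗) (k : ℤ) (x y : 𝓗) :
    ⟪(U ^ k : 𝓗 ≃ₗᵢ[ℂ] 𝓗) x, U.symm y⟫_ℂ = ⟪(U ^ (k + 1) : 𝓗 ≃ₗᵢ[ℂ] 𝓗) x, y⟫_ℂ := by
  rw [zpow_add_one_apply]
  exact (LinearIsometryEquiv.inner_map_eq_flip U _ y).symm

theorem inner_zpow_map (U : 𝓗 ≃ₗᵢ[ℂ] 𝓗) (k : ℤ) (x y : 𝓗) :
    ⟪(U ^ k : 𝓗 ≃ₗᵢ[ℂ] 𝓗) x, U y⟫_ℂ = ⟪(U ^ (k - 1) : 𝓗 ≃ₗᵢ[ℂ] 𝓗) x, y⟫_ℂ := by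
  rw [← LinearIsometryEquiv.symm_apply_apply U y, inner_zpow_symm, sub_add_cancel,
    LinearIsometryEquiv.symm_apply_apply]

/-- The predicate `p` lets one criterion on generators serve both `spanPlus` and `spanMinus`. -/
theorem mem_orthogonal_span_shifted (U : 𝓗 ≃ₗᵢ[ℂ] 𝓗) (V : 𝓛 →ₗᵢ[ℂ] 𝓗) (p : ℤ → Prop) (y : 𝓗) :
    y ∈ ((⨆ k : ℤ, ⨆ _ : p k, shifted U (rangeOf V) k).topologicalClosure)ᗮ ↔
      ∀ k, p k → ∀ a, ⟪(U ^ k : 𝓗 ≃ₗᵢ[ℂ] 𝓗) (V a), y⟫_ℂ = 0 := by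
  rw [Submodule.orthogonal_closure]
  simp only [← Submodule.iInf_orthogonal, Submodule.mem_iInf]
  refine forall_congr' fun k => ?_
  by_cases hk : p k
  · simp only [hk, iSup_pos, forall_const, Submodule.mem_orthogonal]
    constructor
    · intro h a
      exact h _ ⟨V a, ⟨a, rfl⟩, rfl⟩
    · rintro h _ ⟨_, ⟨a, rfl⟩, rfl⟩
      exact h a
  · simp [hk]

theorem zpow_apply_mem_spanPlus (U : 𝓗 ≃ₗᵢ[ℂ] 𝓗) (V : 𝓛 →ₗᵢ[ℂ] 𝓗) {k : ℤ} (hk : 0 ≤ k)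
    (a : 𝓛) : (U ^ k : 𝓗 ≃ₗᵢ[ℂ] 𝓗) (V a) ∈ spanPlus U (rangeOf V) :=
  Submodule.le_topologicalClosure _
    (Submodule.mem_iSup_of_mem k (Submodule.mem_iSup_of_mem hk ⟨V a, ⟨a, rfl⟩, rfl⟩))

theorem zpow_apply_mem_spanMinus (U : 𝓗 ≃ₗᵢ[ℂ] 𝓗) (V : 𝓛 →ₗᵢ[ℂ] 𝓗) {k : ℤ} (hk : k ≤ -1)
    (a : 𝓛) : (U ^ k : 𝓗 ≃ₗᵢ[ℂ] 𝓗) (V a) ∈ spanMinus U (rangeOf V) :=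
  Submodule.le_topologicalClosure _
    (Submodule.mem_iSup_of_mem k (Submodule.mem_iSup_of_mem hk ⟨V a, ⟨a, rfl⟩, rfl⟩))

theorem zpow_apply_mem_spanAll (U : 𝓗 ≃ₗᵢ[ℂ] 𝓗) (V : 𝓛 →ₗᵢ[ℂ] 𝓗) (k : ℤ) (a : 𝓛) :
    (U ^ k : 𝓗 ≃ₗᵢ[ℂ] 𝓗) (V a) ∈ spanAll U (rangeOf V) :=
  Submodule.le_topologicalClosure _
    (Submodule.mem_iSup_of_mem k ⟨V a, ⟨a, rfl⟩, rfl⟩)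

theorem IsWandering.inner_zpow_zpow {U : 𝓗 ≃ₗᵢ[ℂ] 𝓗} {V : 𝓛 →ₗᵢ[ℂ] 𝓗}
    (hV : IsWandering U (rangeOf V)) {j k : ℤ} (hjk : j ≠ k) (a b : 𝓛) :
    ⟪(U ^ j : 𝓗 ≃ₗᵢ[ℂ] 𝓗) (V a), (U ^ k : 𝓗 ≃ₗᵢ[ℂ] 𝓗) (V b)⟫_ℂ = 0 :=
  orthogonalFamily_shift hV hjk a b

theorem IsWandering.inner_zpow_left {U : 𝓗 ≃ₗᵢ[ℂ] 𝓗} {V : 𝓛 →ₗᵢ[ℂ] 𝓗}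
    (hV : IsWandering U (rangeOf V)) {j : ℤ} (hj : j ≠ 0) (a b : 𝓛) :
    ⟪(U ^ j : 𝓗 ≃ₗᵢ[ℂ] 𝓗) (V a), V b⟫_ℂ = 0 := by
  have := hV.inner_zpow_zpow hj a b
  rwa [zpow_zero] at this

end Shifts

/-! ### Geometry of the internal space and unitarity of the generated colligation. -/

namespace UnitaryCoupling

variable {𝓗 𝓕 𝓖 : Type*}
  [NormedAddCommGroup 𝓗] [InnerProductSpace ℂ 𝓗] [CompleteSpace 𝓗]
  [NormedAddCommGroup 𝓕] [InnerProductSpace ℂ 𝓕] [CompleteSpace 𝓕]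
  [NormedAddCommGroup 𝓖] [InnerProductSpace ℂ 𝓖] [CompleteSpace 𝓖]
  {σ : UnitaryCoupling 𝓗 𝓕 𝓖}

theorem mem_internal {y : 𝓗} : y ∈ σ.internal ↔
    (∀ k : ℤ, k ≤ -1 → ∀ f, ⟪(σ.U ^ k : 𝓗 ≃ₗᵢ[ℂ] 𝓗) (σ.VF f), y⟫_ℂ = 0) ∧
      ∀ k : ℤ, 0 ≤ k → ∀ g, ⟪(σ.U ^ k : 𝓗 ≃ₗᵢ[ℂ] 𝓗) (σ.VG g), y⟫_ℂ = 0 := by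
  rw [internal, ← Submodule.inf_orthogonal, Submodule.mem_inf]
  exact and_congr (mem_orthogonal_span_shifted _ _ _ _) (mem_orthogonal_span_shifted _ _ _ _)

theorem inner_VG_internal {y : 𝓗} (hy : y ∈ σ.internal) (g : 𝓖) : ⟪σ.VG g, y⟫_ℂ = 0 := by
  have := (mem_internal.1 hy).2 0 le_rfl g
  rwa [zpow_zero] at this

theorem inner_VF_map_internal {y : 𝓗} (hy : y ∈ σ.internal) (f : 𝓕) :
    ⟪σ.VF f, σ.U y⟫_ℂ = 0 := by
  have h := inner_zpow_map σ.U 0 (σ.VF f) y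
  rw [zero_sub, (mem_internal.1 hy).1 _ le_rfl, zpow_zero] at h
  exact h

theorem inner_adjoint_VF (f : 𝓕) (x : 𝓗) :
    ⟪f, σ.VF.toContinuousLinearMap.adjoint x⟫_ℂ = ⟪σ.VF f, x⟫_ℂ :=
  ContinuousLinearMap.adjoint_inner_right _ _ _

theorem inner_adjoint_VG (g : 𝓖) (x : 𝓗) :
    ⟪g, σ.VG.toContinuousLinearMap.adjoint x⟫_ℂ = ⟪σ.VG g, x⟫_ℂ :=
  ContinuousLinearMap.adjoint_inner_right _ _ _

theorem adjoint_VF_VF (f : 𝓕) : σ.VF.toContinuousLinearMap.adjoint (σ.VF f) = f :=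
  ext_inner_left ℂ fun a => by rw [inner_adjoint_VF, LinearIsometry.inner_map_map]

theorem adjoint_VG_VG (g : 𝓖) : σ.VG.toContinuousLinearMap.adjoint (σ.VG g) = g :=
  ext_inner_left ℂ fun a => by rw [inner_adjoint_VG, LinearIsometry.inner_map_map]

theorem IsOrthogonal.inner_eq_zero (hσ : σ.IsOrthogonal) {j k : ℤ} (hj : j ≤ -1) (hk : 0 ≤ k)
    (f : 𝓕) (g : 𝓖) :
    ⟪(σ.U ^ j : 𝓗 ≃ₗᵢ[ℂ] 𝓗) (σ.VF f), (σ.U ^ k : 𝓗 ≃ₗᵢ[ℂ] 𝓗) (σ.VG g)⟫_ℂ = 0 :=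
  Submodule.isOrtho_iff_inner_eq.1 hσ _ (zpow_apply_mem_spanMinus _ _ hj f) _
    (zpow_apply_mem_spanPlus _ _ hk g)

theorem IsOrthogonal.inner_VF_VG (hσ : σ.IsOrthogonal) {j : ℤ} (hj : j ≤ -1) (f : 𝓕) (g : 𝓖) :
    ⟪(σ.U ^ j : 𝓗 ≃ₗᵢ[ℂ] 𝓗) (σ.VF f), σ.VG g⟫_ℂ = 0 := by
  have := hσ.inner_eq_zero hj le_rfl f g
  rwa [zpow_zero] at this

theorem IsOrthogonal.inner_VG_VF (hσ : σ.IsOrthogonal) {k : ℤ} (hk : 1 ≤ k) (g : 𝓖) (f : 𝓕) :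
    ⟪(σ.U ^ k : 𝓗 ≃ₗᵢ[ℂ] 𝓗) (σ.VG g), σ.VF f⟫_ℂ = 0 := by
  -- Applying `U` to both vectors turns the exponents `(-1, k - 1)` into `(0, k)`; this is why `k ≥
  -- 1` is needed.
  have h := hσ.inner_eq_zero (j := -1) (k := k - 1) le_rfl (by omega) f g
  rw [← inner_conj_symm, ← inner_zpow_map, map_eq_zero] at h
  have h2 := zpow_add_one_apply σ.U (-1) (σ.VF f)
  rw [neg_add_cancel, zpow_zero] at h2
  rwa [← h2] at h

theorem eq_projection_internal {x y : 𝓗} (hy : y ∈ σ.internal)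
    (h : ∀ z ∈ σ.internal, ⟪x - y, z⟫_ℂ = 0) : (σ.internal.orthogonalProjectionOnto x : 𝓗) = y := by
  rw [Submodule.coe_orthogonalProjectionOnto_apply]
  exact Submodule.eq_starProjection_of_mem_of_inner_eq_zero hy h

/-- The vector `w = U y + V_𝓕 f` is orthogonal to `M_-(𝓕)` and to `U M_+(𝓖)`, so it lies in `K ⊕ V_𝓖
𝓖`. Subtracting `V_𝓖 V_𝓖* w` removes the only remaining obstruction, the exponent `k = 0`. -/
theorem IsOrthogonal.projection_add_VG (hσ : σ.IsOrthogonal) (y : σ.internal) (f : 𝓕) :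
    (σ.internal.orthogonalProjectionOnto (σ.U y + σ.VF f) : 𝓗)
      + σ.VG (σ.VG.toContinuousLinearMap.adjoint (σ.U y + σ.VF f)) = σ.U y + σ.VF f := by
  set w := σ.U y + σ.VF f with hw
  set g := σ.VG.toContinuousLinearMap.adjoint w with hg
  rw [eq_projection_internal (y := w - σ.VG g), sub_add_cancel]
  · refine mem_internal.2 ⟨fun k hk a => ?_, fun k hk a => ?_⟩
    · rw [inner_sub_right, hσ.inner_VF_VG hk, hw, inner_add_right, inner_zpow_map,
        (mem_internal.1 y.2).1 _ (by omega), σ.wanderingF.inner_zpow_left (by omega)]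
      simp
    · rcases hk.eq_or_lt with rfl | hk
      · rw [zpow_zero, inner_sub_right]
        change ⟪σ.VG a, w⟫_ℂ - ⟪σ.VG a, σ.VG g⟫_ℂ = 0
        rw [LinearIsometry.inner_map_map, hg, inner_adjoint_VG, sub_self]
      · rw [inner_sub_right, σ.wanderingG.inner_zpow_left hk.ne', hw, inner_add_right,
          inner_zpow_map, (mem_internal.1 y.2).2 _ (by omega), hσ.inner_VG_VF hk]
        simp
  · intro z hz
    rw [sub_sub_cancel]
    exact inner_VG_internal hz g

/-- The time-reversed counterpart of `projection_add_VG`: here `w` lies in `U K ⊕ V_𝓕 𝓕`, and the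
obstruction is the exponent `k = -1`. -/
theorem IsOrthogonal.projection_add_VF (hσ : σ.IsOrthogonal) (y : σ.internal) (g : 𝓖) :
    σ.U (σ.internal.orthogonalProjectionOnto (σ.U.symm (y + σ.VG g)) : 𝓗)
      + σ.VF (σ.VF.toContinuousLinearMap.adjoint (y + σ.VG g)) = y + σ.VG g := by
  set w := (y : 𝓗) + σ.VG g with hw
  set f := σ.VF.toContinuousLinearMap.adjoint w with hf
  rw [eq_projection_internal (y := σ.U.symm (w - σ.VF f)), LinearIsometryEquiv.apply_symm_apply,
    sub_add_cancel]
  · refine mem_internal.2 ⟨fun k hk a => ?_, fun k hk a => ?_⟩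
    · rw [inner_zpow_symm]
      rcases hk.eq_or_lt with rfl | hk
      · rw [neg_add_cancel, zpow_zero, inner_sub_right]
        change ⟪σ.VF a, w⟫_ℂ - ⟪σ.VF a, σ.VF f⟫_ℂ = 0
        rw [LinearIsometry.inner_map_map, hf, inner_adjoint_VF, sub_self]
      · rw [inner_sub_right, σ.wanderingF.inner_zpow_left (by omega), hw, inner_add_right,
          (mem_internal.1 y.2).1 _ (by omega), hσ.inner_VF_VG (by omega)]
        simp
    · rw [inner_zpow_symm, inner_sub_right, hσ.inner_VG_VF (by omega), hw, inner_add_right,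
        (mem_internal.1 y.2).2 _ (by omega), σ.wanderingG.inner_zpow_left (by omega)]
      simp
  · intro z hz
    rw [← map_sub, sub_sub_cancel, LinearIsometryEquiv.inner_map_eq_flip]
    exact inner_VF_map_internal hz f

theorem adjoint_UL : σ.UL.adjoint = (σ.U.symm.toContinuousLinearEquiv : 𝓗 →L[ℂ] 𝓗) := by
  symm
  rw [ContinuousLinearMap.eq_adjoint_iff]
  intro x y
  have := LinearIsometryEquiv.inner_map_eq_flip σ.U.symm x y
  rwa [LinearIsometryEquiv.symm_symm] at this

theorem projection_symm_VF (f : 𝓕) :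
    σ.internal.orthogonalProjectionOnto (σ.U.symm (σ.VF f)) = 0 := by
  rw [Submodule.orthogonalProjectionOnto_eq_zero_iff, Submodule.mem_orthogonal']
  intro y hy
  rw [LinearIsometryEquiv.inner_map_eq_flip]
  exact inner_VF_map_internal hy f

theorem projection_VG (g : 𝓖) : σ.internal.orthogonalProjectionOnto (σ.VG g) = 0 := by
  rw [Submodule.orthogonalProjectionOnto_eq_zero_iff, Submodule.mem_orthogonal']
  exact fun y hy => inner_VG_internal hy g

theorem adjoint_VF_map {y : 𝓗} (hy : y ∈ σ.internal) :
    σ.VF.toContinuousLinearMap.adjoint (σ.U y) = 0 :=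
  ext_inner_left ℂ fun f => by rw [inner_adjoint_VF, inner_VF_map_internal hy, inner_zero_right]

theorem adjoint_VG_internal {y : 𝓗} (hy : y ∈ σ.internal) :
    σ.VG.toContinuousLinearMap.adjoint y = 0 :=
  ext_inner_left ℂ fun g => by rw [inner_adjoint_VG, inner_VG_internal hy, inner_zero_right]

theorem IsOrthogonal.isUnitary_generatedColligation (hσ : σ.IsOrthogonal) :
    σ.generatedColligation.IsUnitary := by
  set P := σ.internal.orthogonalProjectionOnto
  have hT (y : σ.internal) : σ.generatedColligation.T y = P (σ.U y) := rfl
  have hF (f : 𝓕) : σ.generatedColligation.F f = P (σ.VF f) := rfl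
  have hG (y : σ.internal) :
    σ.generatedColligation.G y = σ.VG.toContinuousLinearMap.adjoint (σ.U y) := rfl
  have hS (f : 𝓕) :
    σ.generatedColligation.S f = σ.VG.toContinuousLinearMap.adjoint (σ.VF f) := rfl
  have hT' (y : σ.internal) : σ.generatedColligation.assoc.T y = P (σ.U.symm y) := by
    simp only [Colligation.assoc, generatedColligation, ContinuousLinearMap.adjoint_comp,
      Submodule.adjoint_orthogonalProjectionOnto, Submodule.adjoint_subtypeL, adjoint_UL]
    rfl
  have hF' (g : 𝓖) : σ.generatedColligation.assoc.F g = P (σ.U.symm (σ.VG g)) := by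
    simp only [Colligation.assoc, generatedColligation, ContinuousLinearMap.adjoint_comp,
      ContinuousLinearMap.adjoint_adjoint, Submodule.adjoint_subtypeL, adjoint_UL]
    rfl
  have hG' (y : σ.internal) :
      σ.generatedColligation.assoc.G y = σ.VF.toContinuousLinearMap.adjoint y := by
    simp only [Colligation.assoc, generatedColligation, ContinuousLinearMap.adjoint_comp,
      Submodule.adjoint_orthogonalProjectionOnto]
    rfl
  have hS' (g : 𝓖) :
      σ.generatedColligation.assoc.S g = σ.VF.toContinuousLinearMap.adjoint (σ.VG g) := by
    simp only [Colligation.assoc, generatedColligation, ContinuousLinearMap.adjoint_comp,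
      ContinuousLinearMap.adjoint_adjoint]
    rfl
  rw [Colligation.IsUnitary, Colligation.adjoint_blockOperator]
  constructor <;> refine ContinuousLinearMap.ext fun x => ?_
  · simp only [ContinuousLinearMap.comp_apply, Colligation.blockOperator_apply, WithLp.toLp_fst,
      WithLp.toLp_snd, hT, hF, hG, hS, hT', hF', hG', hS', ← map_add]
    -- The associated block operator sees the output `(P w, V_𝓖* w)` only through `P w + V_𝓖 V_𝓖*
    -- w`, which is `w = U y + V_𝓕 f` itself.
    rw [hσ.projection_add_VG, map_add, map_add, map_add, LinearIsometryEquiv.symm_apply_apply,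
      adjoint_VF_VF, projection_symm_VF, adjoint_VF_map x.fst.2, zero_add, add_zero,
      Submodule.orthogonalProjectionOnto_mem_subspace_eq_self]
    rfl
  · simp only [ContinuousLinearMap.comp_apply, Colligation.blockOperator_apply, WithLp.toLp_fst,
      WithLp.toLp_snd, hT, hF, hG, hS, hT', hF', hG', hS', ← map_add]
    rw [hσ.projection_add_VF, map_add, map_add, adjoint_VG_VG, projection_VG,
      adjoint_VG_internal x.fst.2, zero_add, add_zero,
      Submodule.orthogonalProjectionOnto_mem_subspace_eq_self]
    rfl

/-! ### Evolution of inputs under `U` and the Taylor coefficients. -/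

/-- An element orthogonal to the past differs from its internal component by an element of the
future. -/
theorem IsOrthogonal.sub_projection_mem_spanPlus (hσ : σ.IsOrthogonal) {x : 𝓗}
    (hx : x ∈ (spanMinus σ.U (rangeOf σ.VF))ᗮ) :
    x - σ.internal.orthogonalProjectionOnto x ∈ spanPlus σ.U (rangeOf σ.VG) := by
  have : CompleteSpace (spanPlus σ.U (rangeOf σ.VG)) :=
    (Submodule.isClosed_topologicalClosure _).completeSpace_coe
  set m := (spanPlus σ.U (rangeOf σ.VG)).starProjection x with hm
  have hm' : m ∈ spanPlus σ.U (rangeOf σ.VG) := Submodule.starProjection_apply_mem _ _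
  -- Removing the future part keeps orthogonality to the past, as past and future are orthogonal.
  have h1 : x - m ∈ σ.internal := by
    rw [internal, ← Submodule.inf_orthogonal, Submodule.mem_inf]
    refine ⟨Submodule.sub_mem _ hx ?_, Submodule.sub_starProjection_mem_orthogonal _⟩
    exact Submodule.isOrtho_iff_le.1 hσ.symm hm'
  rw [eq_projection_internal h1, sub_sub_cancel]
  · exact hm'
  · intro z hz
    rw [sub_sub_cancel]
    rw [internal, ← Submodule.inf_orthogonal, Submodule.mem_inf] at hz
    exact hz.2 m hm'

/-- The future is invariant under `U` and orthogonal to the internal space, so nothing flows back.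
-/
theorem projection_map_of_mem_spanPlus {m : 𝓗} (hm : m ∈ spanPlus σ.U (rangeOf σ.VG)) :
    σ.internal.orthogonalProjectionOnto (σ.U m) = 0 := by
  rw [Submodule.orthogonalProjectionOnto_eq_zero_iff, Submodule.mem_orthogonal']
  intro y hy
  rw [LinearIsometryEquiv.inner_map_eq_flip]
  refine ((mem_orthogonal_span_shifted σ.U σ.VG (0 ≤ ·) _).2 fun k hk a => ?_) m hm
  rw [inner_zpow_symm]
  exact (mem_internal.1 hy).2 _ (by omega) a

/-- `U` raises the exponents of the future to at least `1`, away from `V_𝓖 𝓖`. -/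
theorem adjoint_VG_map_of_mem_spanPlus {m : 𝓗} (hm : m ∈ spanPlus σ.U (rangeOf σ.VG)) :
    σ.VG.toContinuousLinearMap.adjoint (σ.U m) = 0 := by
  refine ext_inner_right ℂ fun a => ?_
  rw [ContinuousLinearMap.adjoint_inner_left, inner_zero_left,
    LinearIsometryEquiv.inner_map_eq_flip]
  refine ((mem_orthogonal_span_shifted σ.U σ.VG (0 ≤ ·) _).2 fun k hk b => ?_) m hm
  rw [inner_zpow_symm]
  exact σ.wanderingG.inner_zpow_left (by omega) b a

theorem zpow_VF_mem_orthogonal (n : ℕ) (f : 𝓕) :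
    (σ.U ^ (n : ℤ) : 𝓗 ≃ₗᵢ[ℂ] 𝓗) (σ.VF f) ∈ (spanMinus σ.U (rangeOf σ.VF))ᗮ :=
  (mem_orthogonal_span_shifted σ.U σ.VF (· ≤ -1) _).2 fun _ hk a =>
    σ.wanderingF.inner_zpow_zpow (by omega) a f

/-- Each step may discard the component in the future, so the internal component evolves by `T`
alone. -/
theorem IsOrthogonal.projection_zpow_VF (hσ : σ.IsOrthogonal) (n : ℕ) (f : 𝓕) :
    σ.internal.orthogonalProjectionOnto ((σ.U ^ (n : ℤ) : 𝓗 ≃ₗᵢ[ℂ] 𝓗) (σ.VF f))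
      = (σ.generatedColligation.T ^ n) (σ.generatedColligation.F f) := by
  induction n with
  | zero => rfl
  | succ n ih =>
    have h := projection_map_of_mem_spanPlus
      (hσ.sub_projection_mem_spanPlus (zpow_VF_mem_orthogonal n f))
    rw [map_sub, map_sub, sub_eq_zero] at h
    rw [Nat.cast_succ, zpow_add_one_apply, h, ih, pow_succ']
    rfl

theorem IsOrthogonal.adjoint_VG_zpow_VF (hσ : σ.IsOrthogonal) (n : ℕ) (f : 𝓕) :
    σ.VG.toContinuousLinearMap.adjoint ((σ.U ^ (n : ℤ) : 𝓗 ≃ₗᵢ[ℂ] 𝓗) (σ.VF f))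
      = σ.generatedColligation.taylorCoeff n f := by
  cases n with
  | zero => rfl
  | succ n =>
    have h := adjoint_VG_map_of_mem_spanPlus
      (hσ.sub_projection_mem_spanPlus (zpow_VF_mem_orthogonal n f))
    rw [map_sub, map_sub, sub_eq_zero] at h
    rw [Nat.cast_succ, zpow_add_one_apply, h, hσ.projection_zpow_VF]
    rfl

/-- The operator `V_𝓕* U⁻ⁿ V_𝓖` is the adjoint of `V_𝓖* Uⁿ V_𝓕`; this is why the associated
colligation appears. -/
theorem IsOrthogonal.coefficient_VG (hσ : σ.IsOrthogonal) (n : ℕ) (g : 𝓖) :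
    coefficient σ.U σ.VF n (σ.VG g) = σ.generatedColligation.assoc.taylorCoeff n g := by
  refine ext_inner_left ℂ fun f => ?_
  rw [inner_coefficient, ← Colligation.adjoint_taylorCoeff, ContinuousLinearMap.adjoint_inner_right,
    ← hσ.adjoint_VG_zpow_VF, ContinuousLinearMap.adjoint_inner_left]
  rfl

theorem IsOrthogonal.coefficient_VG_of_neg (hσ : σ.IsOrthogonal) {k : ℤ} (hk : k < 0) (g : 𝓖) :
    coefficient σ.U σ.VF k (σ.VG g) = 0 := by
  refine ext_inner_left ℂ fun f => ?_
  rw [inner_coefficient, hσ.inner_VF_VG (by omega), inner_zero_right]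

end UnitaryCoupling

/-! ## Poisson integrals of vector-valued functions and Fatou's theorem -/

section Poisson

/-- Arc against chord: the chord of angle `θ` has length `2 |sin (θ / 2)|`, and Jordan's inequality
bounds the sine below. -/
theorem dist_le_norm_circlePoint_sub (x y : UCircle) :
    dist x y ≤ π / 2 * ‖circlePoint x - circlePoint y‖ := by
  have h1 : ‖circlePoint x - circlePoint y‖ = ‖circlePoint (x - y) - 1‖ := by
    have h2 : circlePoint x = circlePoint (x - y) * circlePoint y := by
      rw [circlePoint, circlePoint, circlePoint, ← Circle.coe_mul, ← AddCircle.toCircle_add,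
        sub_add_cancel]
    rw [h2, ← sub_one_mul, norm_mul, norm_circlePoint, mul_one]
  rw [h1, dist_eq_norm]
  obtain ⟨θ, hθ, hθ'⟩ : ∃ θ : ℝ, |θ| ≤ π ∧ (θ : UCircle) = x - y := by
    refine ⟨AddCircle.equivIco (2 * π) (-π) (x - y), ?_,
      (AddCircle.equivIco (2 * π) (-π)).symm_apply_apply (x - y)⟩
    have := (AddCircle.equivIco (2 * π) (-π) (x - y)).2
    rw [abs_le]
    constructor <;> linarith [this.1, this.2]
  rw [← hθ', (AddCircle.norm_coe_eq_abs_iff (2 * π) (by positivity)).2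
    (by rw [abs_of_pos Real.two_pi_pos]; linarith)]
  have h3 : circlePoint (θ : UCircle) = Complex.exp (Complex.I * θ) := by
    rw [circlePoint, AddCircle.toCircle_apply_mk, Circle.coe_exp, div_self Real.two_pi_pos.ne',
      one_mul, mul_comm]
  have h4 := Real.mul_abs_le_abs_sin (x := θ / 2) (by rw [abs_div, abs_two]; linarith)
  rw [h3, Complex.norm_exp_I_mul_ofReal_sub_one, norm_mul, Real.norm_two, Real.norm_eq_abs]
  rw [abs_div, abs_two] at h4
  calc |θ| = π * (2 / π * (|θ| / 2)) := by field_simp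
    _ ≤ π * |Real.sin (θ / 2)| := by gcongr
    _ = _ := by ring

/-- The Poisson kernel of the unit disc. -/
def poisson (ζ : ℂ) (x : UCircle) : ℝ := (1 - ‖ζ‖ ^ 2) / ‖circlePoint x - ζ‖ ^ 2

theorem circlePoint_sub_ne_zero {ζ : ℂ} (hζ : ‖ζ‖ < 1) (x : UCircle) : circlePoint x - ζ ≠ 0 := by
  intro h
  rw [← sub_eq_zero.1 h, norm_circlePoint] at hζ
  exact hζ.false

theorem continuous_poisson {ζ : ℂ} (hζ : ‖ζ‖ < 1) : Continuous (poisson ζ) := by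
  refine continuous_const.div ((continuous_circlePoint.sub continuous_const).norm.pow 2) fun x => ?_
  exact pow_ne_zero 2 (norm_ne_zero_iff.2 (circlePoint_sub_ne_zero hζ x))

theorem poisson_nonneg {ζ : ℂ} (hζ : ‖ζ‖ < 1) (x : UCircle) : 0 ≤ poisson ζ x := by
  have : ‖ζ‖ ^ 2 ≤ 1 := pow_le_one₀ (norm_nonneg _) hζ.le
  exact div_nonneg (by linarith) (by positivity)

/-- For `ζ` in the approach region, `‖t - ζ‖` dominates `1 - ‖ζ‖` and, up to the factor `M + 1`, the
chord from `t` to `t₀`. This trades the moving center `ζ` for the fixed center `x₀`; the leading `2`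
comes from `1 - ‖ζ‖² ≤ 2 (1 - ‖ζ‖)`. -/
theorem poisson_le {M : ℝ} {x₀ : UCircle} {ζ : ℂ} (hζ : ζ ∈ approachRegion M (circlePoint x₀))
    (x : UCircle) :
    poisson ζ x ≤ 2 * (1 + (π / 2 * (M + 1)) ^ 2) *
      ((1 - ‖ζ‖) / ((1 - ‖ζ‖) ^ 2 + dist x x₀ ^ 2)) := by
  obtain ⟨h1, h2⟩ := hζ
  have hδ : 0 < 1 - ‖ζ‖ := by linarith
  have h3 : 1 - ‖ζ‖ ≤ ‖circlePoint x - ζ‖ := by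
    have := norm_sub_norm_le (circlePoint x) ζ
    rwa [norm_circlePoint] at this
  have hM : 0 < M := pos_of_mul_pos_left ((norm_nonneg _).trans_lt h2) hδ.le
  have h4 : ‖circlePoint x - circlePoint x₀‖ ≤ (M + 1) * ‖circlePoint x - ζ‖ := by
    calc _ ≤ ‖circlePoint x - ζ‖ + ‖ζ - circlePoint x₀‖ := norm_sub_le_norm_sub_add_norm_sub _ _ _
      _ ≤ ‖circlePoint x - ζ‖ + M * ‖circlePoint x - ζ‖ := by nlinarith
      _ = _ := by ring
  have h5 : dist x x₀ ≤ π / 2 * (M + 1) * ‖circlePoint x - ζ‖ := by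
    refine (dist_le_norm_circlePoint_sub x x₀).trans ?_
    rw [mul_assoc]
    gcongr
  have h6 : (1 - ‖ζ‖) ^ 2 + dist x x₀ ^ 2
      ≤ (1 + (π / 2 * (M + 1)) ^ 2) * ‖circlePoint x - ζ‖ ^ 2 := by
    have h7 := pow_le_pow_left₀ dist_nonneg h5 2
    have h8 := pow_le_pow_left₀ hδ.le h3 2
    rw [mul_pow] at h7
    linarith
  have h9 : 0 < ‖circlePoint x - ζ‖ := hδ.trans_le h3
  have h10 : 1 - ‖ζ‖ ^ 2 ≤ 2 * (1 - ‖ζ‖) := by nlinarith [sq_nonneg (1 - ‖ζ‖)]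
  have h11 := (one_le_div₀ (by positivity)).2 h6
  rw [poisson, div_le_iff₀ (by positivity)]
  calc _ ≤ 2 * (1 - ‖ζ‖) * 1 := by rwa [mul_one]
    _ ≤ 2 * (1 - ‖ζ‖) * _ := mul_le_mul_of_nonneg_left h11 (by positivity)
    _ = _ := by ring

/-- The kernel is the sum of two geometric series, in `ζ / t` and its conjugate. The second starts
at exponent `1` so that the constant term is counted once. -/
theorem hasSum_poisson {ζ : ℂ} (hζ : ‖ζ‖ < 1) (x : UCircle) :
    HasSum (fun n : ℕ => ζ ^ n * fourier (-n : ℤ) x + conj ζ ^ (n + 1) * fourier (n + 1 : ℤ) x)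
      (poisson ζ x : ℂ) := by
  set t := circlePoint x with ht
  have ht1 : t * conj t = 1 := by
    rw [Complex.mul_conj, Complex.normSq_eq_norm_sq, norm_circlePoint]
    simp
  have hw : ‖ζ * conj t‖ < 1 := by
    rwa [norm_mul, RCLike.norm_conj, norm_circlePoint, mul_one]
  have hw' : ‖conj ζ * t‖ < 1 := by
    rwa [norm_mul, RCLike.norm_conj, norm_circlePoint, mul_one]
  have h1 := (hasSum_geometric_of_norm_lt_one hw).add
    ((hasSum_geometric_of_norm_lt_one hw').mul_left (conj ζ * t))
  have hval : (poisson ζ x : ℂ) = (1 - ζ * conj t)⁻¹ + conj ζ * t * (1 - conj ζ * t)⁻¹ := by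
    have h2 : 1 - ζ * conj t ≠ 0 := fun h => by
      rw [← sub_eq_zero.1 h, norm_one] at hw
      exact hw.false
    have h3 : 1 - conj ζ * t ≠ 0 := fun h => by
      rw [← sub_eq_zero.1 h, norm_one] at hw'
      exact hw'.false
    have h4 : ((‖t - ζ‖ ^ 2 : ℝ) : ℂ) = (1 - ζ * conj t) * (1 - conj ζ * t) := by
      rw [← Complex.normSq_eq_norm_sq, ← Complex.mul_conj, map_sub]
      linear_combination (1 - ζ * conj ζ) * (ht1)
    have h5 : ((‖ζ‖ ^ 2 : ℝ) : ℂ) = ζ * conj ζ := by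
      rw [← Complex.normSq_eq_norm_sq, ← Complex.mul_conj]
    rw [poisson, Complex.ofReal_div, ← ht, h4, Complex.ofReal_sub, h5, Complex.ofReal_one]
    field_simp
    linear_combination (ζ * conj ζ) * ht1
  rw [hval]
  refine Eq.mpr (congrArg (HasSum · _) (funext fun n => ?_)) h1
  rw [fourier_neg, ← circlePoint_zpow, ← circlePoint_zpow, ← ht, mul_pow, ← pow_succ',
    mul_pow (conj ζ) t, zpow_natCast, map_pow]
  norm_cast

variable {E : Type*} [NormedAddCommGroup E] [NormedSpace ℂ E]

/-- The Poisson integral of a function without negative Fourier coefficients is its power series. -/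
theorem hasSum_integral_poisson {φ : UCircle → E} (hφ : Integrable φ circleMeasure)
    (hneg : ∀ n : ℕ, fourierCoeff φ (-(n + 1 : ℤ)) = 0) {ζ : ℂ} (hζ : ‖ζ‖ < 1) :
    HasSum (fun n : ℕ => ζ ^ n • fourierCoeff φ n)
      (∫ x, poisson ζ x • φ x ∂circleMeasure) := by
  set F : ℕ → UCircle → E := fun n x =>
    (ζ ^ n * fourier (-n : ℤ) x + conj ζ ^ (n + 1) * fourier (n + 1 : ℤ) x) • φ x with hF
  have hF' (n : ℕ) : F n = fun x =>
      ζ ^ n • fourier (-n : ℤ) x • φ x + conj ζ ^ (n + 1) • fourier (n + 1 : ℤ) x • φ x := by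
    ext x
    simp only [hF, add_smul, mul_smul]
  have hint (n : ℕ) : Integrable (F n) circleMeasure := by
    rw [hF']
    exact ((hφ.fourier_smul _).smul _).add ((hφ.fourier_smul _).smul _)
  have hval (n : ℕ) : ∫ x, F n x ∂circleMeasure = ζ ^ n • fourierCoeff φ n := by
    simp only [hF']
    have h1 : Integrable (fun x => ζ ^ n • fourier (-n : ℤ) x • φ x) circleMeasure :=
      (hφ.fourier_smul _).smul _
    have h2 : Integrable (fun x => conj ζ ^ (n + 1) • fourier (n + 1 : ℤ) x • φ x) circleMeasure :=
      (hφ.fourier_smul _).smul _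
    rw [integral_add h1 h2, integral_smul, integral_smul]
    have h := hneg n
    rw [fourierCoeff, neg_neg] at h
    rw [h, smul_zero, add_zero]
    rfl
  have hnorm (n : ℕ) (x : UCircle) : ‖F n x‖ ≤ ‖ζ‖ ^ n * (2 * ‖φ x‖) := by
    simp only [hF]
    rw [norm_smul, ← mul_assoc]
    refine mul_le_mul_of_nonneg_right ?_ (norm_nonneg _)
    rw [mul_two]
    refine (norm_add_le _ _).trans (add_le_add ?_ ?_)
    · rw [norm_mul, norm_pow, ← circlePoint_zpow, norm_zpow, norm_circlePoint, one_zpow, mul_one]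
    · rw [norm_mul, norm_pow, ← circlePoint_zpow, norm_zpow, norm_circlePoint, one_zpow, mul_one,
        RCLike.norm_conj]
      exact pow_le_pow_of_le_one (norm_nonneg _) hζ.le (Nat.le_succ n)
  have hsum : Summable fun n => ∫ x, ‖F n x‖ ∂circleMeasure := by
    refine Summable.of_nonneg_of_le (fun n => integral_nonneg fun x => norm_nonneg _) (fun n => ?_)
      ((summable_geometric_of_lt_one (norm_nonneg ζ) hζ).mul_right
        (∫ x, 2 * ‖φ x‖ ∂circleMeasure))
    rw [← integral_const_mul]
    exact integral_mono (hint n).norm ((hφ.norm.const_mul 2).const_mul _) (hnorm n)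
  have h := hasSum_integral_of_summable_integral_norm hint hsum
  simp only [hval] at h
  convert h using 1
  refine integral_congr_ae (ae_of_all _ fun x => ?_)
  simp only [hF]
  rw [((hasSum_poisson hζ x).smul_const (φ x)).tsum_eq, Complex.coe_smul]

end Poisson

/-! ### Lebesgue points and nontangential convergence of Poisson integrals. -/

section Fatou

/-- A measure whose balls around `x₀` have at most linear growth has bounded integrals against the
kernels `δ / (δ ^ 2 + dist x x₀ ^ 2)`. -/
theorem lintegral_kernel_le {X : Type*} [PseudoMetricSpace X] [MeasurableSpace X]
    [OpensMeasurableSpace X] (ν : Measure X) (x₀ : X) (c : ℝ≥0∞)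
    (h : ∀ r > 0, ν (Metric.closedBall x₀ r) ≤ c * ENNReal.ofReal r) {δ : ℝ} (hδ : 0 < δ) :
    ∫⁻ x, ENNReal.ofReal (δ / (δ ^ 2 + dist x x₀ ^ 2)) ∂ν ≤ c * 8 := by
  -- Dyadic balls: if `n` is the least index with `x` in the ball of radius `2 ^ n δ`, the kernel is
  -- at most `4 · 4⁻ⁿ / δ` there. Against linear growth these weights sum to `4 ∑ 2⁻ⁿ = 8`.
  have hpt (x : X) : ENNReal.ofReal (δ / (δ ^ 2 + dist x x₀ ^ 2)) ≤
      ∑' n : ℕ, (Metric.closedBall x₀ (2 ^ n * δ)).indicator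
        (fun _ => ENNReal.ofReal (4 * (1 / 4) ^ n / δ)) x := by
    classical
    have hex : ∃ n : ℕ, dist x x₀ ≤ 2 ^ n * δ := by
      obtain ⟨n, hn⟩ := pow_unbounded_of_one_lt (dist x x₀ / δ) one_lt_two
      exact ⟨n, by rw [div_lt_iff₀ hδ] at hn; exact hn.le⟩
    refine le_trans ?_ (ENNReal.le_tsum (Nat.find hex))
    rw [Set.indicator_of_mem (Metric.mem_closedBall.2 (Nat.find_spec hex))]
    refine ENNReal.ofReal_le_ofReal ?_
    rw [div_le_div_iff₀ (by positivity) hδ]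
    rcases hn : Nat.find hex with _ | n
    · nlinarith [sq_nonneg (dist x x₀)]
    · have h1 : 2 ^ n * δ < dist x x₀ := not_le.1 (Nat.find_min hex (by omega))
      have h2 : (2 ^ n * δ) ^ 2 ≤ dist x x₀ ^ 2 := pow_le_pow_left₀ (by positivity) h1.le 2
      have h3 : (4 : ℝ) * (1 / 4) ^ (n + 1) * (2 ^ n) ^ 2 = 1 := by
        rw [← pow_mul, mul_comm n 2, pow_mul, pow_succ, mul_comm ((1 / 4 : ℝ) ^ n), ← mul_assoc,
          mul_assoc, ← mul_pow]
        norm_num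
      calc δ * δ = 4 * (1 / 4) ^ (n + 1) * (2 ^ n) ^ 2 * (δ * δ) := by rw [h3, one_mul]
        _ = 4 * (1 / 4) ^ (n + 1) * (2 ^ n * δ) ^ 2 := by ring
        _ ≤ _ := by
          gcongr
          nlinarith [sq_nonneg δ]
  calc _ ≤ ∫⁻ x, ∑' n : ℕ, (Metric.closedBall x₀ (2 ^ n * δ)).indicator
        (fun _ => ENNReal.ofReal (4 * (1 / 4) ^ n / δ)) x ∂ν := lintegral_mono hpt
    _ = ∑' n : ℕ, ENNReal.ofReal (4 * (1 / 4) ^ n / δ) * ν (Metric.closedBall x₀ (2 ^ n * δ)) := by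
      rw [lintegral_tsum fun n =>
        (measurable_const.indicator measurableSet_closedBall).aemeasurable]
      exact tsum_congr fun n => lintegral_indicator_const measurableSet_closedBall _
    _ ≤ ∑' n : ℕ, c * ENNReal.ofReal (4 * (1 / 2) ^ n) := by
      refine ENNReal.tsum_le_tsum fun n => ?_
      calc _ ≤ ENNReal.ofReal (4 * (1 / 4) ^ n / δ) * (c * ENNReal.ofReal (2 ^ n * δ)) := by
            gcongr
            exact h _ (by positivity)
        _ = c * ENNReal.ofReal (4 * (1 / 4) ^ n / δ * (2 ^ n * δ)) := by
          rw [mul_left_comm, ← ENNReal.ofReal_mul (by positivity)]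
        _ = _ := by
          congr 2
          have h4 : (1 / 2 : ℝ) ^ n = (1 / 4) ^ n * 2 ^ n := by
            rw [← mul_pow]
            norm_num
          rw [h4]
          field_simp
    _ = c * 8 := by
      rw [ENNReal.tsum_mul_left, ← ENNReal.ofReal_tsum_of_nonneg (fun n => by positivity)
        (summable_geometric_two.mul_left 4), tsum_mul_left, tsum_geometric_two]
      norm_num

variable {E : Type*} [NormedAddCommGroup E]

/-- The point `x₀` is a Lebesgue point of `φ`. -/
def IsLebesguePoint (φ : UCircle → E) (x₀ : UCircle) : Prop :=
  ∀ ε : ℝ≥0∞, 0 < ε → ∃ r₀ : ℝ, 0 < r₀ ∧ ∀ r : ℝ, 0 < r → r ≤ r₀ →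
    ∫⁻ x in Metric.closedBall x₀ r, ‖φ x - φ x₀‖ₑ ∂circleMeasure ≤ ε * ENNReal.ofReal r

theorem circleMeasure_le_volume : circleMeasure ≤ (volume : Measure UCircle) := by
  rw [AddCircle.volume_eq_smul_haarAddCircle]
  refine Measure.le_intro fun s _ _ => ?_
  rw [Measure.smul_apply, smul_eq_mul]
  refine le_mul_of_one_le_left' ?_
  rw [ENNReal.one_le_ofReal]
  linarith [Real.pi_gt_three]

theorem ae_isLebesguePoint {φ : UCircle → E} (hφ : Integrable φ circleMeasure) :
    ∀ᵐ x ∂circleMeasure, IsLebesguePoint φ x := by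
  have hφ' : Integrable φ (volume : Measure UCircle) := by
    rw [AddCircle.volume_eq_smul_haarAddCircle]
    exact hφ.smul_measure ENNReal.ofReal_ne_top
  refine ae_mono circleMeasure_le_volume ?_
  filter_upwards [(IsUnifLocDoublingMeasure.vitaliFamily (volume : Measure UCircle) 1
    ).ae_tendsto_lintegral_enorm_sub_div hφ'.locallyIntegrable] with x hx ε hε
  have h1 := hx.comp (IsUnifLocDoublingMeasure.tendsto_closedBall_filterAt volume
    (fun _ : ℝ => x) id tendsto_id (K := 1) (l := 𝓝[>] 0) (by
      filter_upwards [self_mem_nhdsWithin] with r hr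
      rw [one_mul]
      exact Metric.mem_closedBall_self (le_of_lt hr)))
  -- Half of `ε`, because a ball of radius `r` has length at most `2 r`.
  have h2 := (ENNReal.tendsto_nhds_zero.1 h1) (ε / 2) (ENNReal.half_pos hε.ne')
  obtain ⟨r₀, hr₀, h3⟩ := mem_nhdsGT_iff_exists_Ioc_subset.1 h2
  refine ⟨r₀, hr₀, fun r hr hr' => ?_⟩
  have h4 : (∫⁻ y in Metric.closedBall x r, ‖φ y - φ x‖ₑ) / volume (Metric.closedBall x r)
      ≤ ε / 2 := h3 ⟨hr, hr'⟩
  rw [ENNReal.div_le_iff (Metric.measure_closedBall_pos _ _ hr).ne' (measure_ne_top _ _)] at h4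
  calc _ ≤ ∫⁻ y in Metric.closedBall x r, ‖φ y - φ x‖ₑ :=
        lintegral_mono' (Measure.restrict_mono subset_rfl circleMeasure_le_volume) le_rfl
    _ ≤ ε / 2 * ENNReal.ofReal (2 * r) := by
      refine h4.trans ?_
      gcongr
      rw [AddCircle.volume_closedBall]
      exact ENNReal.ofReal_le_ofReal (min_le_right _ _)
    _ = ε * ENNReal.ofReal r := by
      rw [ENNReal.ofReal_mul zero_le_two, ← mul_assoc, ENNReal.ofReal_ofNat,
        ENNReal.div_mul_cancel two_ne_zero ENNReal.ofNat_ne_top]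

/-- Near `x₀`, the Lebesgue point condition bounds the growth of `‖φ - φ x₀‖` on balls and
`lintegral_kernel_le` applies. Away from `x₀` the kernel is uniformly `O(1 - ‖ζ‖)`. -/
theorem tendsto_lintegral_poisson {φ : UCircle → E} (hφ : Integrable φ circleMeasure)
    {x₀ : UCircle} (hx₀ : IsLebesguePoint φ x₀) (M : ℝ) :
    Tendsto (fun ζ => ∫⁻ x, ENNReal.ofReal (poisson ζ x) * ‖φ x - φ x₀‖ₑ ∂circleMeasure)
      (𝓝[approachRegion M (circlePoint x₀)] circlePoint x₀) (𝓝 0) := by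
  set A : ℝ := 2 * (1 + (π / 2 * (M + 1)) ^ 2) with hA
  have hA0 : 0 < A := by positivity
  set ψ : UCircle → ℝ≥0∞ := fun x => ‖φ x - φ x₀‖ₑ with hψ
  have hψm : AEMeasurable ψ circleMeasure :=
    (hφ.1.sub aestronglyMeasurable_const).enorm
  have hψi : ∫⁻ x, ψ x ∂circleMeasure ≠ ∞ := (hφ.sub (integrable_const (φ x₀))).2.ne
  rw [ENNReal.tendsto_nhds_zero]
  intro ε hε
  -- Chosen so that the near part is at most `A · (c · 8) = ε / 2`.
  set c : ℝ≥0∞ := ε / 2 / 8 / ENNReal.ofReal A with hc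
  have hc0 : 0 < c := by
    refine ENNReal.div_pos (ENNReal.div_pos (ENNReal.half_pos hε.ne').ne' ?_).ne' ?_ <;> finiteness
  obtain ⟨r₀, hr₀, hr⟩ := hx₀ c hc0
  -- Restriction to the ball of radius `r₀` extends the growth bound to all radii.
  set ν : Measure UCircle :=
    (circleMeasure.restrict (Metric.closedBall x₀ r₀)).withDensity ψ with hν
  have hνb (r : ℝ) (h0 : 0 < r) : ν (Metric.closedBall x₀ r) ≤ c * ENNReal.ofReal r := by
    rw [hν, withDensity_apply _ measurableSet_closedBall,
      Measure.restrict_restrict measurableSet_closedBall]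
    rcases le_total r r₀ with h1 | h1
    · exact (lintegral_mono' (Measure.restrict_mono Set.inter_subset_left le_rfl) le_rfl).trans
        (hr r h0 h1)
    · refine (lintegral_mono' (Measure.restrict_mono Set.inter_subset_right le_rfl) le_rfl).trans
        ((hr r₀ hr₀ le_rfl).trans ?_)
      gcongr
  have hfar : Tendsto (fun ζ : ℂ => ENNReal.ofReal (A * ((1 - ‖ζ‖) / r₀ ^ 2)) *
      ∫⁻ x, ψ x ∂circleMeasure) (𝓝[approachRegion M (circlePoint x₀)] circlePoint x₀) (𝓝 0) := by
    have h1 : Tendsto (fun ζ : ℂ => A * ((1 - ‖ζ‖) / r₀ ^ 2)) (𝓝 (circlePoint x₀)) (𝓝 0) := by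
      have h2 : Continuous fun ζ : ℂ => A * ((1 - ‖ζ‖) / r₀ ^ 2) := by fun_prop
      have h3 := h2.tendsto (circlePoint x₀)
      rwa [norm_circlePoint, sub_self, zero_div, mul_zero] at h3
    have h4 := ENNReal.Tendsto.mul_const
      (f := 𝓝[approachRegion M (circlePoint x₀)] circlePoint x₀) (b := ∫⁻ x, ψ x ∂circleMeasure)
      (ENNReal.tendsto_ofReal (h1.mono_left nhdsWithin_le_nhds)) (Or.inr hψi)
    rwa [ENNReal.ofReal_zero, zero_mul] at h4
  filter_upwards [self_mem_nhdsWithin,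
    (ENNReal.tendsto_nhds_zero.1 hfar) (ε / 2) (ENNReal.half_pos hε.ne')] with ζ hζ hζfar
  have hδ : 0 < 1 - ‖ζ‖ := by linarith [hζ.1]
  set k : UCircle → ℝ := fun x => (1 - ‖ζ‖) / ((1 - ‖ζ‖) ^ 2 + dist x x₀ ^ 2) with hk
  have hkm : Measurable fun x => ENNReal.ofReal (k x) := by
    have : Continuous k := by
      refine continuous_const.div (by fun_prop) fun x => ?_
      positivity
    exact this.measurable.ennreal_ofReal
  rw [← lintegral_add_compl _ (measurableSet_closedBall (x := x₀) (ε := r₀)),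
    ← ENNReal.add_halves ε]
  refine add_le_add ?_ (le_trans ?_ hζfar)
  · calc _ ≤ ∫⁻ x in Metric.closedBall x₀ r₀, ENNReal.ofReal A * (ψ x * ENNReal.ofReal (k x))
            ∂circleMeasure := by
          refine lintegral_mono fun x => ?_
          rw [mul_left_comm, mul_comm]
          refine mul_le_mul_right ?_ _
          rw [← ENNReal.ofReal_mul hA0.le]
          exact ENNReal.ofReal_le_ofReal (poisson_le hζ x)
      _ = ENNReal.ofReal A * ∫⁻ x, ENNReal.ofReal (k x) ∂ν := by
        rw [lintegral_const_mul'' (f := fun x => ψ x * ENNReal.ofReal (k x)) _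
          (hψm.restrict.mul hkm.aemeasurable), hν,
          lintegral_withDensity_eq_lintegral_mul₀ hψm.restrict hkm.aemeasurable]
        rfl
      _ ≤ ENNReal.ofReal A * (c * 8) := by
        gcongr
        exact lintegral_kernel_le ν x₀ c hνb hδ
      _ = ε / 2 := by
        rw [← mul_assoc, hc, ENNReal.mul_div_cancel (by simpa using hA0) (by finiteness),
          ENNReal.div_mul_cancel (by norm_num) (by norm_num)]
  · rw [← lintegral_const_mul'' _ hψm]
    refine (lintegral_mono_ae ?_).trans (setLIntegral_le_lintegral _ _)
    filter_upwards [ae_restrict_mem measurableSet_closedBall.compl] with x hx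
    gcongr
    refine (poisson_le hζ x).trans ?_
    gcongr
    have h5 : r₀ < dist x x₀ := by simpa using hx
    have h6 := pow_le_pow_left₀ hr₀.le h5.le 2
    nlinarith [sq_nonneg (1 - ‖ζ‖)]

variable [NormedSpace ℂ E]

theorem fourierCoeff_const_of_ne_zero [CompleteSpace E] (a : E) {n : ℤ} (hn : n ≠ 0) :
    fourierCoeff (fun _ : UCircle => a) n = 0 := by
  have h := congrFun (fourierCoeff_fourier (T := 2 * π) 0) n
  rw [Pi.single_eq_of_ne hn] at h
  simp only [fourierCoeff, fourier_zero, smul_eq_mul, mul_one] at h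
  rw [fourierCoeff, integral_smul_const, h, zero_smul]

theorem fourierCoeff_const_zero [CompleteSpace E] (a : E) :
    fourierCoeff (fun _ : UCircle => a) 0 = a := by
  simp [fourierCoeff]

theorem integral_poisson {ζ : ℂ} (hζ : ‖ζ‖ < 1) :
    ∫ x, poisson ζ x ∂circleMeasure = 1 := by
  have h := hasSum_integral_poisson (integrable_const (1 : ℂ))
    (fun n => fourierCoeff_const_of_ne_zero 1 (by omega)) hζ
  have h2 := h.unique (hasSum_single 0 fun n hn => by
    rw [fourierCoeff_const_of_ne_zero 1 (by omega), smul_zero])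
  rw [Nat.cast_zero, fourierCoeff_const_zero, pow_zero, one_smul, integral_smul_const,
    Complex.real_smul, mul_one] at h2
  exact_mod_cast h2

/-- **Fatou's theorem** for Poisson integrals, at Lebesgue points. -/
theorem tendsto_integral_poisson [CompleteSpace E] {φ : UCircle → E}
    (hφ : Integrable φ circleMeasure)
    {x₀ : UCircle} (hx₀ : IsLebesguePoint φ x₀) (M : ℝ) :
    Tendsto (fun ζ => ∫ x, poisson ζ x • φ x ∂circleMeasure)
      (𝓝[approachRegion M (circlePoint x₀)] circlePoint x₀) (𝓝 (φ x₀)) := by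
  rw [tendsto_iff_edist_tendsto_0]
  refine tendsto_of_tendsto_of_tendsto_of_le_of_le' tendsto_const_nhds
    (tendsto_lintegral_poisson hφ hx₀ M) (Eventually.of_forall fun _ => zero_le) ?_
  filter_upwards [self_mem_nhdsWithin] with ζ hζ
  have hint : Integrable (fun x => poisson ζ x) circleMeasure :=
    (continuous_poisson hζ.1).integrable_of_hasCompactSupport (HasCompactSupport.of_compactSpace _)
  have hint' : Integrable (fun x => poisson ζ x • φ x) circleMeasure := by
    obtain ⟨C, hC⟩ := isCompact_univ.exists_bound_of_continuousOn
      (continuous_poisson hζ.1).continuousOn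
    exact hφ.bdd_smul (φ := poisson ζ) C (continuous_poisson hζ.1).aestronglyMeasurable
      (ae_of_all _ fun x => hC x (Set.mem_univ x))
  -- Total mass one turns the error into the integral of the kernel against `φ - φ x₀`.
  have h1 : φ x₀ = ∫ x, poisson ζ x • φ x₀ ∂circleMeasure := by
    rw [integral_smul_const, integral_poisson hζ.1, one_smul]
  rw [edist_eq_enorm_sub]
  nth_rewrite 1 [h1]
  rw [← integral_sub hint' (hint.smul_const _)]
  refine (enorm_integral_le_lintegral_enorm _).trans (lintegral_mono fun x => ?_)
  rw [← smul_sub, enorm_smul, Real.enorm_of_nonneg (poisson_nonneg hζ.1 x)]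

/-- The radius ending at `t` lies in the region of aperture `2`, so nontangential limits are unique.
-/
theorem approachRegion_neBot (x : UCircle) :
    (𝓝[approachRegion 2 (circlePoint x)] circlePoint x).NeBot := by
  rw [← mem_closure_iff_nhdsWithin_neBot]
  have h1 : Tendsto (fun r : ℝ => (r : ℂ) * circlePoint x) (𝓝[<] 1) (𝓝 (circlePoint x)) := by
    have h2 : Continuous fun r : ℝ => (r : ℂ) * circlePoint x := by fun_prop
    have h3 := h2.tendsto 1
    rw [Complex.ofReal_one, one_mul] at h3
    exact h3.mono_left nhdsWithin_le_nhds
  refine mem_closure_of_tendsto h1 ?_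
  filter_upwards [Ioo_mem_nhdsLT zero_lt_one] with r hr
  have h4 : ‖(r : ℂ) * circlePoint x‖ = r := by
    rw [norm_mul, norm_circlePoint, mul_one, Complex.norm_real, Real.norm_of_nonneg hr.1.le]
  have h5 : ‖(r : ℂ) * circlePoint x - circlePoint x‖ = 1 - r := by
    rw [← sub_one_mul, norm_mul, norm_circlePoint, mul_one, ← Complex.ofReal_one,
      ← Complex.ofReal_sub, Complex.norm_real, Real.norm_of_nonpos (by linarith [hr.2]), neg_sub]
  exact ⟨by rw [h4]; exact hr.2, by rw [h4, h5]; linarith [hr.2]⟩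

end Fatou

/-! ## Fourier series in `L²(𝓛)` -/

section FourierSeries

variable {𝓛 : Type*} [NormedAddCommGroup 𝓛] [InnerProductSpace ℂ 𝓛]

theorem coeFn_monomial (k : ℤ) (a : 𝓛) :
    monomial k a =ᵐ[circleMeasure] fun x => circlePoint x ^ k • a :=
  (memLp_monomial k a).coeFn_toLp

/-- The functions `t ^ k a` are total in `L²(𝓛)`. -/
theorem eq_top_of_monomial_mem {p : Submodule ℂ (L2 𝓛)} (hp : IsClosed (p : Set (L2 𝓛)))
    (h : ∀ k a, monomial k a ∈ p) : p = ⊤ := by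
  -- For fixed `a`, completeness of the scalar exponentials puts every `f · a` with `f` in scalar
  -- `L²` into `p`. Indicator functions `f` then yield all simple functions.
  have hscalar (a : 𝓛) (f : L2 ℂ) :
      ((ContinuousLinearMap.id ℂ ℂ).smulRight a).compLpL 2 circleMeasure f ∈ p := by
    set A := ((ContinuousLinearMap.id ℂ ℂ).smulRight a).compLpL 2 circleMeasure
    have h1 : Submodule.span ℂ (Set.range (fourierLp (T := 2 * π) 2)) ≤
        p.comap A.toLinearMap := by
      rw [Submodule.span_le]
      rintro _ ⟨k, rfl⟩
      change A (fourierLp 2 k) ∈ p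
      convert h k a using 1
      refine Lp.ext ?_
      filter_upwards [ContinuousLinearMap.coeFn_compLpL (p := 2)
        ((ContinuousLinearMap.id ℂ ℂ).smulRight a) (fourierLp (T := 2 * π) 2 k),
        coeFn_fourierLp (T := 2 * π) 2 k, coeFn_monomial k a] with x h1 h2 h3
      rw [h1, h2, h3, circlePoint_zpow]
      rfl
    have h2 := Submodule.topologicalClosure_minimal _ h1 (hp.preimage A.continuous)
    rw [span_fourierLp_closure_eq_top (by norm_num)] at h2
    exact h2 (Submodule.mem_top (x := f))
  rw [eq_top_iff]
  rintro f -
  refine Lp.induction (p := 2) (by norm_num) (motive := fun f => f ∈ p) ?_ ?_ hp f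
  · intro c s hs hμs
    convert hscalar c (indicatorConstLp 2 hs hμs.ne 1) using 1
    refine Lp.ext ?_
    rw [Lp.simpleFunc.coe_indicatorConst]
    filter_upwards [ContinuousLinearMap.coeFn_compLpL (p := 2)
      ((ContinuousLinearMap.id ℂ ℂ).smulRight c) (indicatorConstLp 2 hs hμs.ne 1),
      indicatorConstLp_coeFn (p := 2) (hs := hs) (hμs := hμs.ne) (c := (1 : ℂ)),
      indicatorConstLp_coeFn (p := 2) (hs := hs) (hμs := hμs.ne) (c := c)] with x h1 h2 h3
    rw [h1, h2, h3]
    by_cases hx : x ∈ s <;> simp [hx]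
  · intro f g hf hg _ h1 h2
    exact p.add_mem h1 h2

theorem ext_inner_monomial {f g : L2 𝓛}
    (h : ∀ k a, ⟪monomial k a, f⟫_ℂ = ⟪monomial k a, g⟫_ℂ) : f = g := by
  have h1 : (ℂ ∙ (f - g))ᗮ = ⊤ := by
    refine eq_top_of_monomial_mem (Submodule.isClosed_orthogonal _) fun k a => ?_
    rw [Submodule.mem_orthogonal_singleton_iff_inner_left, inner_sub_right, h, sub_self]
  have h2 : f - g ∈ (ℂ ∙ (f - g))ᗮ := h1 ▸ Submodule.mem_top
  rw [Submodule.mem_orthogonal_singleton_iff_inner_left, inner_self_eq_zero] at h2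
  exact sub_eq_zero.1 h2

theorem integrable_L2 (f : L2 𝓛) : Integrable f circleMeasure :=
  (Lp.memLp f).integrable one_le_two

theorem inner_fourierCoeff [CompleteSpace 𝓛] (f : L2 𝓛) (k : ℤ) (a : 𝓛) :
    ⟪a, fourierCoeff f k⟫_ℂ = ⟪monomial k a, f⟫_ℂ := by
  rw [fourierCoeff, ← integral_inner ((integrable_L2 f).fourier_smul _), L2.inner_def]
  refine integral_congr_ae ?_
  filter_upwards [coeFn_monomial k a] with x hx
  rw [hx, inner_smul_left, inner_smul_right, circlePoint_zpow, ← fourier_neg]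

variable {𝓗 : Type*} [NormedAddCommGroup 𝓗] [InnerProductSpace ℂ 𝓗] [CompleteSpace 𝓗]
  [CompleteSpace 𝓛]

theorem inner_monomial_fourierRep {U : 𝓗 ≃ₗᵢ[ℂ] 𝓗} {V : 𝓛 →ₗᵢ[ℂ] 𝓗}
    (hV : IsWandering U (rangeOf V)) (h : 𝓗) (k : ℤ) (a : 𝓛) :
    ⟪monomial k a, fourierRep U V hV h⟫_ℂ = ⟪(U ^ k : 𝓗 ≃ₗᵢ[ℂ] 𝓗) (V a), h⟫_ℂ := by
  have h1 := (hasSum_coefficient hV h).summable.hasSum.mapL (innerSL ℂ (monomial k a))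
  refine (h1.unique (hasSum_single k fun j hj => ?_)).trans ?_
  · rw [innerSL_apply_apply, inner_monomial, if_neg hj.symm]
  · rw [innerSL_apply_apply, inner_monomial, if_pos rfl, inner_coefficient]

theorem fourierCoeff_fourierRep {U : 𝓗 ≃ₗᵢ[ℂ] 𝓗} {V : 𝓛 →ₗᵢ[ℂ] 𝓗}
    (hV : IsWandering U (rangeOf V)) (h : 𝓗) (k : ℤ) :
    fourierCoeff (fourierRep U V hV h) k = coefficient U V k h :=
  ext_inner_left ℂ fun a => by
    rw [inner_fourierCoeff, inner_monomial_fourierRep, inner_coefficient]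

theorem memLp_zpow_smul (f : L2 𝓛) (k : ℤ) :
    MemLp (fun x => circlePoint x ^ k • f x) 2 circleMeasure := by
  refine (Lp.memLp f).congr_norm ?_ (ae_of_all _ fun x => ?_)
  · exact (continuous_circlePoint.zpow₀ k fun x => Or.inl
      (circlePoint_ne_zero x)).aestronglyMeasurable.smul (Lp.aestronglyMeasurable f)
  · rw [norm_smul, norm_zpow, norm_circlePoint, one_zpow, one_mul]

/-- The representation intertwines `U` with multiplication by `t`: both sides have as `j`-th
coefficient the `(j - k)`-th coefficient of `h`. -/
theorem fourierRep_zpow {U : 𝓗 ≃ₗᵢ[ℂ] 𝓗} {V : 𝓛 →ₗᵢ[ℂ] 𝓗}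
    (hV : IsWandering U (rangeOf V)) (h : 𝓗) (k : ℤ) :
    fourierRep U V hV ((U ^ k : 𝓗 ≃ₗᵢ[ℂ] 𝓗) h) =ᵐ[circleMeasure]
      fun x => circlePoint x ^ k • fourierRep U V hV h x := by
  suffices h0 : fourierRep U V hV ((U ^ k : 𝓗 ≃ₗᵢ[ℂ] 𝓗) h)
      = (memLp_zpow_smul (fourierRep U V hV h) k).toLp by
    rw [h0]
    exact (memLp_zpow_smul (fourierRep U V hV h) k).coeFn_toLp
  refine ext_inner_monomial fun j a => ?_
  have h1 : ⟪monomial j a, (memLp_zpow_smul (fourierRep U V hV h) k).toLp⟫_ℂ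
      = ⟪monomial (j - k) a, fourierRep U V hV h⟫_ℂ := by
    rw [L2.inner_def, L2.inner_def]
    refine integral_congr_ae ?_
    filter_upwards [(memLp_zpow_smul (fourierRep U V hV h) k).coeFn_toLp, coeFn_monomial j a,
      coeFn_monomial (j - k) a] with x h1 h2 h3
    rw [h1, h2, h3, inner_smul_left, inner_smul_left, inner_smul_right, circlePoint_zpow,
      circlePoint_zpow, circlePoint_zpow, ← fourier_neg, ← fourier_neg, ← mul_assoc, ← fourier_add]
    congr 3
    ring
  rw [h1, inner_monomial_fourierRep, inner_monomial_fourierRep,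
    ← LinearIsometryEquiv.inner_map_map (U ^ k : 𝓗 ≃ₗᵢ[ℂ] 𝓗) ((U ^ (j - k) : 𝓗 ≃ₗᵢ[ℂ] 𝓗) (V a))]
  congr 1
  change _ = ((U ^ k : 𝓗 ≃ₗᵢ[ℂ] 𝓗) * U ^ (j - k)) (V a)
  rw [← zpow_add, add_sub_cancel]

end FourierSeries

/-! ## The scattering operator as a multiplication operator -/

section Scattering

variable {𝓗 𝓕 𝓖 : Type*}
  [NormedAddCommGroup 𝓗] [InnerProductSpace ℂ 𝓗] [CompleteSpace 𝓗]
  [NormedAddCommGroup 𝓕] [InnerProductSpace ℂ 𝓕] [CompleteSpace 𝓕]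
  [NormedAddCommGroup 𝓖] [InnerProductSpace ℂ 𝓖] [CompleteSpace 𝓖]

theorem UnitaryCoupling.adjoint_fourierG_monomial (σ : UnitaryCoupling 𝓗 𝓕 𝓖) (k : ℤ) (g : 𝓖) :
    σ.fourierG.adjoint (monomial k g) =
      ⟨(σ.U ^ k : 𝓗 ≃ₗᵢ[ℂ] 𝓗) (σ.VG g), zpow_apply_mem_spanAll _ _ _ _⟩ := by
  refine ext_inner_right ℂ fun y => ?_
  rw [ContinuousLinearMap.adjoint_inner_left]
  exact inner_monomial_fourierRep σ.wanderingG y k g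

/-- The projection onto `MF` disappears, since `Φ_𝓕` pairs its argument only with vectors of `MF`.
-/
theorem UnitaryCoupling.scatteringOperator_monomial (σ : UnitaryCoupling 𝓗 𝓕 𝓖) (k : ℤ) (g : 𝓖) :
    σ.scatteringOperator (monomial k g) =
      fourierRep σ.U σ.VF σ.wanderingF ((σ.U ^ k : 𝓗 ≃ₗᵢ[ℂ] 𝓗) (σ.VG g)) := by
  refine ext_inner_monomial fun j a => ?_
  rw [inner_monomial_fourierRep]
  change ⟪monomial j a, fourierRep σ.U σ.VF σ.wanderingF
    (σ.MF.orthogonalProjectionOnto (σ.fourierG.adjoint (monomial k g)).1 : 𝓗)⟫_ℂ = _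
  rw [σ.adjoint_fourierG_monomial, inner_monomial_fourierRep]
  exact Submodule.inner_orthogonalProjectionOnto_eq_of_mem_left
    ⟨_, zpow_apply_mem_spanAll σ.U σ.VF j a⟩ _

/-- An operator on `L²(𝓖)` that acts on the functions `t ^ k a` as the multiplication by an operator
function is the multiplication by this function. -/
theorem ae_apply_eq_of_monomial {A : L2 𝓖 →L[ℂ] L2 𝓕} {ϑ : UCircle → 𝓖 →L[ℂ] 𝓕}
    (h : ∀ k a, ∀ᵐ x ∂circleMeasure, ϑ x (monomial k a x) = A (monomial k a) x) (g : L2 𝓖) :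
    ∀ᵐ x ∂circleMeasure, ϑ x (g x) = A g x := by
  let p : Submodule ℂ (L2 𝓖) :=
    { carrier := {g | ∀ᵐ x ∂circleMeasure, ϑ x (g x) = A g x}
      add_mem' := by
        intro f g hf hg
        filter_upwards [hf, hg, Lp.coeFn_add f g, Lp.coeFn_add (A f) (A g)] with x h1 h2 h3 h4
        rw [h3, Pi.add_apply, map_add, h1, h2, map_add, h4, Pi.add_apply]
      zero_mem' := by
        filter_upwards [Lp.coeFn_zero 𝓖 2 circleMeasure, Lp.coeFn_zero 𝓕 2 circleMeasure]
          with x h1 h2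
        rw [h1, Pi.zero_apply, map_zero, map_zero, h2, Pi.zero_apply]
      smul_mem' := by
        intro c f hf
        filter_upwards [hf, Lp.coeFn_smul c f, Lp.coeFn_smul c (A f)] with x h1 h2 h3
        rw [h2, Pi.smul_apply, map_smul, h1, map_smul, h3, Pi.smul_apply] }
  -- Convergence in `L²` gives convergence almost everywhere along a subsequence; a further
  -- subsequence handles the images under `A`, and each `ϑ x` is continuous.
  have hp : IsClosed (p : Set (L2 𝓖)) := by
    refine IsSeqClosed.isClosed fun u g hu hg => ?_
    obtain ⟨n, hn, h1⟩ := (tendstoInMeasure_of_tendsto_Lp hg).exists_seq_tendsto_ae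
    have h2 : Tendsto (fun i => A (u (n i))) atTop (𝓝 (A g)) :=
      (A.continuous.tendsto g).comp (hg.comp hn.tendsto_atTop)
    obtain ⟨m, hm, h3⟩ := (tendstoInMeasure_of_tendsto_Lp h2).exists_seq_tendsto_ae
    have h4 : ∀ᵐ x ∂circleMeasure, ∀ i, ϑ x (u i x) = A (u i) x := ae_all_iff.2 hu
    filter_upwards [h1, h3, h4] with x h1 h3 h4
    refine tendsto_nhds_unique (((ϑ x).continuous.tendsto _).comp (h1.comp hm.tendsto_atTop)) ?_
    refine h3.congr fun i => ?_
    exact (h4 _).symm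
  exact (eq_top_of_monomial_mem hp h ▸ Submodule.mem_top : g ∈ p)

/-! ## Strong boundary values -/

/-- The filter of nontangential convergence to `t`. -/
def nontangential (t : ℂ) : Filter ℂ := ⨆ M : ℝ, 𝓝[approachRegion M t] t

theorem tendsto_nontangential {X : Type*} {f : ℂ → X} {l : Filter X} {t : ℂ} :
    Tendsto f (nontangential t) l ↔ ∀ M : ℝ, Tendsto f (𝓝[approachRegion M t] t) l :=
  tendsto_iSup

theorem nontangential_neBot (x : UCircle) : (nontangential (circlePoint x)).NeBot :=
  (approachRegion_neBot x).mono (le_iSup (fun M : ℝ => 𝓝[approachRegion M (circlePoint x)]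
    circlePoint x) 2)

theorem eventually_nontangential_norm_lt (t : ℂ) : ∀ᶠ ζ in nontangential t, ‖ζ‖ < 1 :=
  eventually_iSup.2 fun _ => eventually_nhdsWithin_of_forall fun _ hζ => hζ.1

theorem isStrongBoundaryValue_iff {θ : ℂ → 𝓖 →L[ℂ] 𝓕} {ϑ : UCircle → 𝓖 →L[ℂ] 𝓕} :
    IsStrongBoundaryValue θ ϑ ↔ ∀ᵐ x ∂circleMeasure, ∀ g : 𝓖,
      Tendsto (fun ζ => θ ζ g) (nontangential (circlePoint x)) (𝓝 (ϑ x g)) := by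
  simp only [IsStrongBoundaryValue, tendsto_nontangential]

/-- Contractions that converge strongly on a dense set converge strongly to a contraction. -/
theorem exists_tendsto_of_dense {ι : Type*} {l : Filter ι} [l.NeBot] {A : ι → 𝓖 →L[ℂ] 𝓕}
    (hA : ∀ᶠ i in l, ‖A i‖ ≤ 1) {D : Set 𝓖} (hD : Dense D)
    (h : ∀ g ∈ D, ∃ y, Tendsto (fun i => A i g) l (𝓝 y)) :
    ∃ B : 𝓖 →L[ℂ] 𝓕, ‖B‖ ≤ 1 ∧ ∀ g, Tendsto (fun i => A i g) l (𝓝 (B g)) := by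
  have h1 (g : 𝓖) : ∃ y, Tendsto (fun i => A i g) l (𝓝 y) := by
    refine CompleteSpace.complete (f := map (fun i => A i g) l) (Metric.cauchy_iff.2
      ⟨inferInstance, fun ε hε => ?_⟩)
    obtain ⟨d, hd, hgd⟩ := hD.exists_dist_lt g (by positivity : 0 < ε / 4)
    obtain ⟨y, hy⟩ := h d hd
    refine ⟨Metric.ball y (ε / 2), ?_, fun a ha b hb => ?_⟩
    · rw [mem_map]
      filter_upwards [hA, Metric.tendsto_nhds.1 hy (ε / 4) (by positivity)] with i h2 h3
      have h4 : dist (A i g) (A i d) ≤ dist g d := by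
        rw [dist_eq_norm, dist_eq_norm, ← map_sub]
        exact (A i).le_of_opNorm_le_of_le h2 le_rfl |>.trans_eq (one_mul _)
      have h5 := dist_triangle (A i g) (A i d) y
      simp only [Set.mem_preimage, Metric.mem_ball]
      linarith
    · have := dist_triangle_right a b y
      rw [Metric.mem_ball] at ha hb
      linarith
  choose B hB using h1
  have h2 : Tendsto (fun i g => (A i : 𝓖 →ₗ[ℂ] 𝓕) g) l (𝓝 B) := tendsto_pi_nhds.2 hB
  refine ⟨(linearMapOfTendsto B (fun i => (A i : 𝓖 →ₗ[ℂ] 𝓕)) h2).mkContinuous 1 fun g => ?_,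
    LinearMap.mkContinuous_norm_le _ zero_le_one _, hB⟩
  refine le_of_tendsto (hB g).norm ?_
  filter_upwards [hA] with i hi
  exact (A i).le_of_opNorm_le hi g

/-! ### Merging exceptional null sets, and uniqueness almost everywhere. -/

variable [TopologicalSpace.SeparableSpace 𝓖]

theorem ae_eq_of_apply {ϑ ϑ' : UCircle → 𝓖 →L[ℂ] 𝓕}
    (h : ∀ g, ∀ᵐ x ∂circleMeasure, ϑ x g = ϑ' x g) : ϑ =ᵐ[circleMeasure] ϑ' := by
  filter_upwards [ae_all_iff.2 fun n => h (TopologicalSpace.denseSeq 𝓖 n)] with x hx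
  refine ContinuousLinearMap.coeFn_injective
    ((TopologicalSpace.denseRange_denseSeq 𝓖).equalizer (ϑ x).continuous (ϑ' x).continuous ?_)
  exact funext hx

/-- The null set in `h` depends on `g`. One null set serves a dense sequence, and the uniform bound
extends convergence at the remaining points to all `g`. -/
theorem exists_isStrongBoundaryValue {θ : ℂ → 𝓖 →L[ℂ] 𝓕} (hθ : ∀ ζ : ℂ, ‖ζ‖ < 1 → ‖θ ζ‖ ≤ 1)
    {φ : 𝓖 → UCircle → 𝓕} (hφ : ∀ g, AEStronglyMeasurable (φ g) circleMeasure)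
    (h : ∀ g, ∀ᵐ x ∂circleMeasure,
      Tendsto (fun ζ => θ ζ g) (nontangential (circlePoint x)) (𝓝 (φ g x))) :
    ∃ ϑ : UCircle → 𝓖 →L[ℂ] 𝓕, IsContractiveMeasurable ϑ ∧ IsStrongBoundaryValue θ ϑ ∧
      ∀ g, ∀ᵐ x ∂circleMeasure, ϑ x g = φ g x := by
  have h1 : ∀ᵐ x ∂circleMeasure, ∃ B : 𝓖 →L[ℂ] 𝓕, ‖B‖ ≤ 1 ∧
      ∀ g, Tendsto (fun ζ => θ ζ g) (nontangential (circlePoint x)) (𝓝 (B g)) := by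
    filter_upwards [ae_all_iff.2 fun n => h (TopologicalSpace.denseSeq 𝓖 n)] with x hx
    have := nontangential_neBot x
    refine exists_tendsto_of_dense ((eventually_nontangential_norm_lt _).mono hθ)
      (TopologicalSpace.denseRange_denseSeq 𝓖) ?_
    rintro _ ⟨n, rfl⟩
    exact ⟨_, hx n⟩
  classical
  let ϑ : UCircle → 𝓖 →L[ℂ] 𝓕 := fun x => if hx : ∃ B : 𝓖 →L[ℂ] 𝓕, ‖B‖ ≤ 1 ∧
      ∀ g, Tendsto (fun ζ => θ ζ g) (nontangential (circlePoint x)) (𝓝 (B g)) then hx.choose else 0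
  have h2 : ∀ᵐ x ∂circleMeasure, ‖ϑ x‖ ≤ 1 ∧
      ∀ g, Tendsto (fun ζ => θ ζ g) (nontangential (circlePoint x)) (𝓝 (ϑ x g)) := by
    filter_upwards [h1] with x hx
    simp only [ϑ, dif_pos hx]
    exact hx.choose_spec
  have h3 (g : 𝓖) : ∀ᵐ x ∂circleMeasure, ϑ x g = φ g x := by
    filter_upwards [h2, h g] with x h2 h3
    have := nontangential_neBot x
    exact tendsto_nhds_unique (h2.2 g) h3
  refine ⟨ϑ, ⟨fun g => (hφ g).congr ((h3 g).mono fun x hx => hx.symm), h2.mono fun x hx => hx.1⟩,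
    isStrongBoundaryValue_iff.2 (h2.mono fun x hx => hx.2), h3⟩

theorem isStrongBoundaryValue_iff_ae_eq {θ : ℂ → 𝓖 →L[ℂ] 𝓕} {ϑ : UCircle → 𝓖 →L[ℂ] 𝓕}
    (h : IsStrongBoundaryValue θ ϑ) (ϑ' : UCircle → 𝓖 →L[ℂ] 𝓕) :
    IsStrongBoundaryValue θ ϑ' ↔ ϑ' =ᵐ[circleMeasure] ϑ := by
  rw [isStrongBoundaryValue_iff] at h ⊢
  constructor
  · intro h'
    filter_upwards [h, h'] with x h1 h2
    have := nontangential_neBot x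
    exact ContinuousLinearMap.ext fun g => tendsto_nhds_unique (h2 g) (h1 g)
  · intro h'
    filter_upwards [h, h'] with x h1 h2
    rwa [h2]

theorem isScatteringSuboperator_iff_ae_eq {σ : UnitaryCoupling 𝓗 𝓕 𝓖} {ϑ : UCircle → 𝓖 →L[ℂ] 𝓕}
    (h : IsScatteringSuboperator σ ϑ) (ϑ' : UCircle → 𝓖 →L[ℂ] 𝓕) :
    IsScatteringSuboperator σ ϑ' ↔ ϑ' =ᵐ[circleMeasure] ϑ := by
  constructor
  · intro h'
    -- Constant functions `monomial 0 g` already determine the multiplier.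
    refine ae_eq_of_apply fun g => ?_
    filter_upwards [h.mul (monomial 0 g), h'.mul (monomial 0 g), coeFn_monomial 0 g]
      with x h1 h2 h3
    rw [h3, zpow_zero, one_smul] at h1 h2
    rw [h1, h2]
  · intro h'
    refine ⟨⟨fun g => (h.mem.measurable g).congr ?_, ?_⟩, fun g => ?_⟩
    · filter_upwards [h'] with x hx
      rw [hx]
    · filter_upwards [h', h.mem.contractive] with x hx h1
      rwa [hx]
    · filter_upwards [h', h.mul g] with x hx h1
      rwa [hx]

/-- The characteristic function of the associated colligation has nontangential limits given by the
Fourier representation. -/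
theorem UnitaryCoupling.IsOrthogonal.ae_tendsto_charFun {σ : UnitaryCoupling 𝓗 𝓕 𝓖}
    (hσ : σ.IsOrthogonal) (g : 𝓖) : ∀ᵐ x ∂circleMeasure,
      Tendsto (fun ζ => σ.generatedColligation.assoc.charFun ζ g) (nontangential (circlePoint x))
        (𝓝 (fourierRep σ.U σ.VF σ.wanderingF (σ.VG g) x)) := by
  set φ := fourierRep σ.U σ.VF σ.wanderingF (σ.VG g) with hφ
  -- Both sides are sums of the same power series: Fourier coefficients of `φ` on one side, Taylor
  -- coefficients on the other.
  have hchar {ζ : ℂ} (hζ : ‖ζ‖ < 1) : ∫ x, poisson ζ x • φ x ∂circleMeasure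
      = σ.generatedColligation.assoc.charFun ζ g := by
    have h1 := hasSum_integral_poisson (integrable_L2 φ) (fun n => by
      rw [hφ, fourierCoeff_fourierRep, hσ.coefficient_VG_of_neg (by omega)]) hζ
    simp only [hφ, fourierCoeff_fourierRep, hσ.coefficient_VG] at h1
    exact h1.unique (Colligation.hasSum_taylorCoeff
      hσ.isUnitary_generatedColligation.assoc.norm_T_le hζ g)
  filter_upwards [ae_isLebesguePoint (integrable_L2 φ)] with x hx
  refine Tendsto.congr' ((eventually_nontangential_norm_lt _).mono fun ζ hζ => hchar hζ) ?_
  exact tendsto_nontangential.2 fun M => tendsto_integral_poisson (integrable_L2 φ) hx M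

end Scattering

end

end ScatteringTheory

theorem theorem4p26 {𝓗 𝓕 𝓖 : Type*}
    [NormedAddCommGroup 𝓗] [InnerProductSpace ℂ 𝓗] [CompleteSpace 𝓗]
    [NormedAddCommGroup 𝓕] [InnerProductSpace ℂ 𝓕] [CompleteSpace 𝓕]
    [TopologicalSpace.SeparableSpace 𝓕]
    [NormedAddCommGroup 𝓖] [InnerProductSpace ℂ 𝓖] [CompleteSpace 𝓖]
    [TopologicalSpace.SeparableSpace 𝓖]
    (σ : UnitaryCoupling 𝓗 𝓕 𝓖) (hσ : σ.IsOrthogonal)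
    (Δ : Colligation σ.internal 𝓕 𝓖) (hΔ : Δ = σ.generatedColligation) :
    Δ.IsUnitary ∧
    IsSchur Δ.assoc.charFun ∧
    (∀ ζ ∈ Metric.ball (0 : ℂ) 1, assocFun Δ.charFun ζ = Δ.assoc.charFun ζ) ∧
    ∃ ϑ : UCircle → 𝓖 →L[ℂ] 𝓕,
      (∀ ϑ' : UCircle → 𝓖 →L[ℂ] 𝓕, IsScatteringSuboperator σ ϑ' ↔ ϑ' =ᵐ[circleMeasure] ϑ) ∧
      (∀ ϑ' : UCircle → 𝓖 →L[ℂ] 𝓕,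
        IsStrongBoundaryValue Δ.assoc.charFun ϑ' ↔ ϑ' =ᵐ[circleMeasure] ϑ) ∧
      (∀ ϑ' : UCircle → 𝓖 →L[ℂ] 𝓕,
        IsStrongBoundaryValue (assocFun Δ.charFun) ϑ' ↔ ϑ' =ᵐ[circleMeasure] ϑ) := by
  subst hΔ
  have hU := hσ.isUnitary_generatedColligation
  have hassoc : assocFun σ.generatedColligation.charFun = σ.generatedColligation.assoc.charFun :=
    funext (Colligation.assocFun_charFun _)
  obtain ⟨ϑ, h1, h2, h3⟩ := exists_isStrongBoundaryValue
    (fun ζ hζ => hU.assoc.norm_charFun_le hζ)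
    (fun g => Lp.aestronglyMeasurable (fourierRep σ.U σ.VF σ.wanderingF (σ.VG g)))
    hσ.ae_tendsto_charFun
  have h4 : IsScatteringSuboperator σ ϑ := by
    -- On `t ^ k a` both operators give `t ^ k` times the representation of `V_𝓖 a`.
    refine ⟨h1, ae_apply_eq_of_monomial fun k a => ?_⟩
    rw [σ.scatteringOperator_monomial]
    filter_upwards [h3 a, coeFn_monomial k a, fourierRep_zpow σ.wanderingF (σ.VG a) k]
      with x h5 h6 h7
    rw [h6, h7, map_smul, h5]
  refine ⟨hU, hU.assoc.isSchur, fun ζ _ => congrFun hassoc ζ, ϑ,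
    isScatteringSuboperator_iff_ae_eq h4, isStrongBoundaryValue_iff_ae_eq h2, ?_⟩
  rw [hassoc]
  exact isStrongBoundaryValue_iff_ae_eq h2
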